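/- Theorem 1. There is a deterministic algorithm in the Congested Clique model that, given any finite simple graph $G$ of unknown girth $g$ (the length of a shortest cycle of $G$, with $g=\infty$ if $G$ has no cycle), runs for $O(1)$ rounds, after which all nodes output one common value $a$ with $g\in\{a,a+1\}$. Here $a$ is an integer if $G$ contains a cycle, and $a=\infty$ if $G$ has no cycle. In the Congested Clique model there are $n$ nodes $1,\dots,n$, which are the vertices of $G$; each node initially knows only $n$, its own identifier and its incident edges in $G$. In every synchronous round, each node may send a message of $O(\log n)$ bits to every other node (possibly different messages to different nodes), and local computation is free. The number of rounds and the constant in the $O(\log n)$ message size are bounded by absolute constants, independent of $n$ and $G$. -/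

import Mathlib

/-- A deterministic algorithm for the Congested Clique on the `n` nodes `Fin n` with messages of
`B` bits and outputs in `O`. Node identifiers are the elements of `Fin n`, and `n` is known to all
nodes. Local computation is free, so the local steps are arbitrary functions of the local state. -/
structure CongestedCliqueAlgorithm (n B : ℕ) (O : Type) where
  /-- The local states of a node. -/
  State : Type
  /-- The initial state, from the node's own identifier and its set of neighbours
  in the input graph (the edges at that node), and nothing else. -/
  init : Fin n → Set (Fin n) → State
  /-- In every round a node with local state `s` sends the `B`-bit message `send s u` to node `u`;
  different recipients may get different messages. -/
  send : State → Fin n → (Fin B → Bool)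
  /-- The new local state, from the old one and the messages received in this round,
  indexed by their senders. -/
  receive : State → (Fin n → (Fin B → Bool)) → State
  /-- The output of a node that stops in the given local state. -/
  output : State → O

namespace CongestedCliqueAlgorithm

variable {n B : ℕ} {O : Type}

/-- The local state of every node after `t` synchronous rounds on the input graph `G`. -/
def stateAfter (A : CongestedCliqueAlgorithm n B O) (G : SimpleGraph (Fin n)) :
    ℕ → Fin n → A.State
  | 0, v => A.init v (G.neighborSet v)
  | t + 1, v => A.receive (A.stateAfter G t v) (fun u => A.send (A.stateAfter G t u) v)

/-- Run on the input graph `G` for `t` rounds, all nodes output the value `a`. -/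
def OutputsAfter (A : CongestedCliqueAlgorithm n B O) (G : SimpleGraph (Fin n)) (t : ℕ) (a : O) :
    Prop :=
  ∀ v : Fin n, A.output (A.stateAfter G t v) = a

end CongestedCliqueAlgorithm

/-! Let `m` be the number of edges and `D = ⌊m/n⌋`. If `D < 6`, there are only `O(n)` edges and
every node can learn the whole graph. Otherwise put `k = ⌊log_D n⌋`. By `egirth_le_two_mul_iff`, the
girth is at most `2r` exactly when two different paths with at most `r` edges share their ends. Let
`s` be the largest level up to `k` without such a pair. Then `g > 2s`, and `g ≤ 2(s + 1)`: by
maximality if `s < k`, and by the weak Moore bound `egirth_le_of_card_lt_pow` if `s = k`. So `g` is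
`2s + 1` or `2s + 2`.

To make all paths with at most `k` edges visible somewhere, the edges are split into `qk` blocks
with `q = ⌊D/3⌋`, and every set of `k` blocks is handed to some node. Since `C(qk, k) ≤ (3q)^k ≤ D^k
≤ n`, there are enough nodes (`exists_cover`), and each node receives only `O(n)` edges. A path with
at most `k` edges meets at most `k` blocks, so some node, its owner, knows all of it.

At a level without a pair, at most one path leads from `v` to each `u`, hence at most `n` paths
start at `v`. The nodes exchange rough counts (`Knows.exchangeGoodLevels`) and keep the largest
level at which every start has an estimated count of at most `n`; its true counts are at most `2n`,
and no level without a pair lies above it. The at most `2n²` paths of that level are cut into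
portions of at most `n`, produced by helpers and reported to their starts, where coinciding ends are
noticed. This is `Knows.twoPathsLevel`.

All transport rests on deterministic routing, `Knows.route`. Relays come from edge colourings of
bipartite multigraphs (`exists_relay`). Each of about `√n` groups shares its message counts, so all
its members compute the same colouring without further communication. Since local computation is
free, `Knows` and `Determines` reduce protocols to statements about which information is a function
of which. -/

namespace CongestedClique

/-! ### Rounds as growth of knowledge. -/

open Finset

variable {n B t : ℕ} {X Y Z : Type}

/-- After `t` rounds with `B`-bit messages, every node `v` of every input graph `G` can know the
value `f G v` (besides its own identifier). -/
def Knows (B t : ℕ) (f : SimpleGraph (Fin n) → Fin n → X) : Prop :=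
  ∃ A : CongestedCliqueAlgorithm n B (Fin n × X), ∀ G v, A.output (A.stateAfter G t v) = (v, f G v)

/-- A node that knows its value of `f` can compute its value of `g`. -/
def Determines (f : SimpleGraph (Fin n) → Fin n → X) (g : SimpleGraph (Fin n) → Fin n → Y) : Prop :=
  ∀ G G' v, f G v = f G' v → g G v = g G' v

theorem Determines.refl (f : SimpleGraph (Fin n) → Fin n → X) : Determines f f :=
  fun _ _ _ h => h

theorem Determines.trans {f : SimpleGraph (Fin n) → Fin n → X} {g : SimpleGraph (Fin n) → Fin n → Y}
    {h : SimpleGraph (Fin n) → Fin n → Z} (hfg : Determines f g) (hgh : Determines g h) :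
    Determines f h :=
  fun _ _ _ e => hgh _ _ _ (hfg _ _ _ e)

theorem Determines.prodMk {f : SimpleGraph (Fin n) → Fin n → X}
    {g : SimpleGraph (Fin n) → Fin n → Y} {h : SimpleGraph (Fin n) → Fin n → Z}
    (hg : Determines f g) (hh : Determines f h) : Determines f (fun G v => (g G v, h G v)) :=
  fun _ _ _ e => Prod.ext (hg _ _ _ e) (hh _ _ _ e)

theorem determines_fst {f : SimpleGraph (Fin n) → Fin n → X}
    {g : SimpleGraph (Fin n) → Fin n → Y} : Determines (fun G v => (f G v, g G v)) f :=
  fun _ _ _ e => congrArg Prod.fst e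

theorem determines_snd {f : SimpleGraph (Fin n) → Fin n → X}
    {g : SimpleGraph (Fin n) → Fin n → Y} : Determines (fun G v => (f G v, g G v)) g :=
  fun _ _ _ e => congrArg Prod.snd e

theorem Determines.map {f : SimpleGraph (Fin n) → Fin n → X} {g : SimpleGraph (Fin n) → Fin n → Y}
    (hfg : Determines f g) (φ : Fin n → Y → Z) : Determines f (fun G v => φ v (g G v)) :=
  fun _ _ v e => congrArg (φ v) (hfg _ _ _ e)

-- Turns functional dependence into an actual local function: from its identifier and its value, a
-- node picks any consistent graph and evaluates `g` there. `Determines` makes the choice of graph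
-- irrelevant.
open Classical in
theorem Determines.exists_factor [Nonempty Y] {f : SimpleGraph (Fin n) → Fin n → X}
    {g : SimpleGraph (Fin n) → Fin n → Y} (h : Determines f g) :
    ∃ φ : Fin n × X → Y, ∀ G v, φ (v, f G v) = g G v := by
  refine ⟨fun p => if hp : ∃ G, f G p.1 = p.2 then g hp.choose p.1 else Classical.arbitrary Y, ?_⟩
  intro G v
  have hp : ∃ G', f G' v = f G v := ⟨G, rfl⟩
  simp only [hp, dif_pos]
  exact h _ _ _ hp.choose_spec

theorem knows_neighborSet (B : ℕ) : Knows B 0 (fun (G : SimpleGraph (Fin n)) v => G.neighborSet v) :=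
  ⟨{ State := Fin n × Set (Fin n)
     init := fun v s => (v, s)
     send := fun _ _ _ => false
     receive := fun s _ => s
     output := id }, fun _ _ => rfl⟩

/-- The algorithm that applies `g` to the output of `A`. -/
def mapOutput (A : CongestedCliqueAlgorithm n B X) (g : X → Y) : CongestedCliqueAlgorithm n B Y :=
  { State := A.State, init := A.init, send := A.send, receive := A.receive
    output := fun s => g (A.output s) }

theorem stateAfter_mapOutput (A : CongestedCliqueAlgorithm n B X) (g : X → Y)
    (G : SimpleGraph (Fin n)) (i : ℕ) (v : Fin n) :
    (mapOutput A g).stateAfter G i v = A.stateAfter G i v := by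
  induction i generalizing v with
  | zero => rfl
  | succ i ih =>
    simp only [CongestedCliqueAlgorithm.stateAfter, ih]
    rfl

/-- Free local computation: the factor map is applied only to the output, so no round is added. -/
theorem Knows.mono {f : SimpleGraph (Fin n) → Fin n → X} {g : SimpleGraph (Fin n) → Fin n → Y}
    [Nonempty Y] (hf : Knows B t f) (h : Determines f g) : Knows B t g := by
  obtain ⟨A, hA⟩ := hf
  obtain ⟨φ, hφ⟩ := h.exists_factor
  refine ⟨mapOutput A fun x => (x.1, φ x), fun G v => ?_⟩
  rw [stateAfter_mapOutput]
  change ((A.output (A.stateAfter G t v)).1, φ (A.output (A.stateAfter G t v))) = _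
  rw [hA, hφ]

theorem Knows.exists_outputsAfter {a : SimpleGraph (Fin n) → X}
    (h : Knows B t fun (G : SimpleGraph (Fin n)) (_ : Fin n) => a G) :
    ∃ A : CongestedCliqueAlgorithm n B X, ∀ G, A.OutputsAfter G t (a G) := by
  obtain ⟨A, hA⟩ := h
  refine ⟨mapOutput A Prod.snd, fun G v => ?_⟩
  rw [stateAfter_mapOutput]
  change (A.output (A.stateAfter G t v)).2 = _
  rw [hA]

/-- One round in which node `v` sends the message `m G v u` to node `u`. -/
theorem Knows.exchange {f : SimpleGraph (Fin n) → Fin n → X} {M : Type} [Fintype M] [Nonempty M]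
    (hM : Fintype.card M ≤ 2 ^ B) (hf : Knows B t f)
    {m : SimpleGraph (Fin n) → Fin n → Fin n → M} (hm : Determines f m) :
    Knows B (t + 1) (fun G v => (f G v, fun u => m G u v)) := by
  classical
  obtain ⟨A, hA⟩ := hf
  obtain ⟨φ, hφ⟩ := hm.exists_factor
  obtain ⟨enc⟩ : Nonempty (M ↪ (Fin B → Bool)) :=
    Function.Embedding.nonempty_of_card_le (by simpa using hM)
  -- `A` does not know when to stop, so the new state carries a round counter: `A` is simulated
  -- while the counter is below `t`, then frozen while the new message is sent. The last incoming
  -- messages are stored for decoding.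
  let A' : CongestedCliqueAlgorithm n B (Fin n × (X × (Fin n → M))) :=
    { State := ℕ × A.State × (Fin n → Fin B → Bool)
      init := fun v s => (0, A.init v s, fun _ _ => false)
      send := fun s u => if s.1 < t then A.send s.2.1 u else enc (φ (A.output s.2.1) u)
      receive := fun s r => if s.1 < t then (s.1 + 1, A.receive s.2.1 r, r) else (s.1 + 1, s.2.1, r)
      output := fun s => ((A.output s.2.1).1, (A.output s.2.1).2,
        fun u => Function.invFun enc (s.2.2 u)) }
  refine ⟨A', fun G v => ?_⟩
  have hs : ∀ i ≤ t, ∀ v, (A'.stateAfter G i v).1 = i ∧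
      (A'.stateAfter G i v).2.1 = A.stateAfter G i v := by
    intro i
    induction i with
    | zero => intro _ v; exact ⟨rfl, rfl⟩
    | succ i ih =>
      intro hi v
      have hsend : ∀ u, A'.send (A'.stateAfter G i u) v = A.send (A.stateAfter G i u) v := by
        intro u
        obtain ⟨h1, h2⟩ := ih (by omega) u
        change (if _ then _ else _) = _
        rw [h1, h2, if_pos (by omega)]
      obtain ⟨h1, h2⟩ := ih (by omega) v
      simp only [CongestedCliqueAlgorithm.stateAfter, hsend]
      change (if _ then _ else _ : ℕ × A.State × (Fin n → Fin B → Bool)).1 = _ ∧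
        (if _ then _ else _ : ℕ × A.State × (Fin n → Fin B → Bool)).2.1 = _
      rw [h1, h2, if_pos (by omega)]
      exact ⟨rfl, rfl⟩
  have hfin : A'.stateAfter G (t + 1) v =
      (t + 1, A.stateAfter G t v, fun u => enc (m G u v)) := by
    have hsend : ∀ u, A'.send (A'.stateAfter G t u) v = enc (m G u v) := by
      intro u
      obtain ⟨h1, h2⟩ := hs t le_rfl u
      change (if _ then _ else _) = _
      rw [h1, h2, if_neg (by omega), hA, hφ]
    obtain ⟨h1, h2⟩ := hs t le_rfl v
    simp only [CongestedCliqueAlgorithm.stateAfter, hsend]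
    change (if _ then _ else _ : ℕ × A.State × (Fin n → Fin B → Bool)) = _
    rw [h1, h2, if_neg (by omega)]
  rw [hfin]
  change ((A.output (A.stateAfter G t v)).1, (A.output (A.stateAfter G t v)).2,
        fun u => Function.invFun enc (enc (m G u v))) = _
  rw [hA]
  simp only [Function.leftInverse_invFun enc.injective _]

/-- One round in which every node `v` sends the same message `m G v` to all nodes. -/
theorem Knows.broadcast {f : SimpleGraph (Fin n) → Fin n → X} {M : Type} [Fintype M] [Nonempty M]
    (hM : Fintype.card M ≤ 2 ^ B) (hf : Knows B t f)
    {m : SimpleGraph (Fin n) → Fin n → M} (hm : Determines f m) :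
    Knows B (t + 1) (fun G v => (f G v, m G)) :=
  hf.exchange hM (hm.map fun _ x _ => x)

/-! ### Bandwidth of sets of messages and direct forwarding. -/

/-- A set of at most `K` elements can be listed in `K` optional entries, so it costs `K` words on a
link. -/
theorem card_finset_card_le_le (M : Type) [Fintype M] [DecidableEq M] (K : ℕ) :
    Fintype.card {S : Finset M // S.card ≤ K} ≤ (Fintype.card M + 1) ^ K := by
  classical
  have : (Fintype.card M + 1) ^ K = Fintype.card (Fin K → Option M) := by simp
  rw [this]
  let F : (Fin K → Option M) → Finset M := fun g => univ.filter fun m => ∃ i, g i = some m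
  have hF : ∀ S : {S : Finset M // S.card ≤ K}, ∃ g, F g = S.1 := by
    intro S
    refine ⟨fun i => if h : i.1 < S.1.card then some (S.1.equivFin.symm ⟨i, h⟩).1 else none, ?_⟩
    ext m
    simp only [F, mem_filter, mem_univ, true_and]
    constructor
    · rintro ⟨i, hi⟩
      split_ifs at hi with h
      · cases hi; exact (S.1.equivFin.symm ⟨i, h⟩).2
    · intro hm
      refine ⟨⟨S.1.equivFin ⟨m, hm⟩, (S.1.equivFin ⟨m, hm⟩).2.trans_le S.2⟩, ?_⟩
      simp
  choose g hg using hF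
  refine Fintype.card_le_of_injective g fun S S' h => Subtype.ext ?_
  rw [← hg S, ← hg S', h]

theorem two_pow_two_mul_log_gt (hn : 2 ≤ n) : n < 2 ^ (2 * Nat.log 2 n) := by
  have h1 : 1 ≤ Nat.log 2 n := Nat.log_pos (by norm_num) hn
  calc n < 2 ^ (Nat.log 2 n + 1) := Nat.lt_pow_succ_log_self (by norm_num) n
    _ ≤ _ := Nat.pow_le_pow_right (by norm_num) (by omega)

theorem pow_le_two_pow_log (hn : 2 ≤ n) (a : ℕ) : n ^ a ≤ 2 ^ (2 * a * Nat.log 2 n) := by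
  calc n ^ a ≤ (2 ^ (2 * Nat.log 2 n)) ^ a := Nat.pow_le_pow_left (two_pow_two_mul_log_gt hn).le a
    _ = _ := by rw [← pow_mul]; congr 1; ring

theorem succ_pow_le_two_pow (hn : 2 ≤ n) {N a K : ℕ} (hN : N ≤ n ^ a)
    (hB : (2 * a + 1) * K * Nat.log 2 n ≤ B) : (N + 1) ^ K ≤ 2 ^ B := by
  have h1 : 1 ≤ Nat.log 2 n := Nat.log_pos (by norm_num) hn
  have h2 : N + 1 ≤ 2 ^ ((2 * a + 1) * Nat.log 2 n) := by
    have h3 : 2 * 2 ^ (2 * a * Nat.log 2 n) ≤ 2 ^ ((2 * a + 1) * Nat.log 2 n) := by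
      rw [← pow_succ']
      exact Nat.pow_le_pow_right (by norm_num) (by linarith)
    have := pow_le_two_pow_log hn a
    have : 1 ≤ 2 ^ (2 * a * Nat.log 2 n) := Nat.one_le_two_pow
    omega
  calc (N + 1) ^ K ≤ (2 ^ ((2 * a + 1) * Nat.log 2 n)) ^ K := Nat.pow_le_pow_left h2 K
    _ = 2 ^ ((2 * a + 1) * K * Nat.log 2 n) := by rw [← pow_mul]; congr 1; ring
    _ ≤ _ := Nat.pow_le_pow_right (by norm_num) hB

variable {Msg : Type} [Fintype Msg] [DecidableEq Msg]

/-- One round in which every message of the set `A G` moves from its location `loc G` to its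
new location `loc' G`, if at most `K` messages use the same link. -/
theorem Knows.forward {f : SimpleGraph (Fin n) → Fin n → X} (hn : 2 ≤ n) (a K : ℕ)
    (hMsg : Fintype.card Msg ≤ n ^ a) (hB : (2 * a + 1) * K * Nat.log 2 n ≤ B)
    (A : SimpleGraph (Fin n) → Finset Msg) (loc loc' : SimpleGraph (Fin n) → Msg → Fin n)
    (hK : ∀ G u v, #{m ∈ A G | loc G m = u ∧ loc' G m = v} ≤ K)
    (hf : Knows B t f) (hA : Determines f fun G v => {m ∈ A G | loc G m = v})
    (hloc : ∀ G G' v, f G v = f G' v → ∀ m ∈ A G, loc G m = v → loc' G m = loc' G' m) :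
    Knows B (t + 1) fun G v => (f G v, {m ∈ A G | loc' G m = v}) := by
  have : Nonempty {S : Finset Msg // S.card ≤ K} := ⟨⟨∅, by simp⟩⟩
  have key := hf.exchange (M := {S : Finset Msg // S.card ≤ K})
    (m := fun G u v => ⟨{m ∈ A G | loc G m = u ∧ loc' G m = v}, hK G u v⟩)
    (hM := (card_finset_card_le_le Msg K).trans (succ_pow_le_two_pow hn hMsg hB)) (by
      intro G G' v h
      have h2 : ∀ m, (m ∈ A G ∧ loc G m = v) ↔ (m ∈ A G' ∧ loc G' m = v) := by
        simpa only [mem_filter] using Finset.ext_iff.1 (hA G G' v h)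
      funext u
      apply Subtype.ext
      ext m
      simp only [mem_filter, ← and_assoc, h2]
      refine and_congr_right fun h3 => ?_
      rw [hloc G G' v h m ((h2 m).2 h3).1 ((h2 m).2 h3).2])
  have : Nonempty X := by
    obtain ⟨A, hA⟩ := hf
    exact ⟨f ⊥ ⟨0, by omega⟩⟩
  refine key.mono (determines_fst.prodMk ?_)
  intro G G' v h
  have h2 : ∀ u m, (m ∈ A G ∧ loc G m = u ∧ loc' G m = v) ↔
      (m ∈ A G' ∧ loc G' m = u ∧ loc' G' m = v) := by
    intro u m
    have h3 := congrArg Subtype.val (congrFun (congrArg Prod.snd h) u)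
    simpa only [mem_filter] using Finset.ext_iff.1 h3 m
  ext m
  simp only [mem_filter]
  constructor
  · rintro ⟨h3, h4⟩
    have := (h2 _ m).1 ⟨h3, rfl, h4⟩
    exact ⟨this.1, this.2.2⟩
  · rintro ⟨h3, h4⟩
    have := (h2 _ m).2 ⟨h3, rfl, h4⟩
    exact ⟨this.1, this.2.2⟩

end CongestedClique

/-! ### Edge colourings, relays and balanced dealing. -/

namespace CongestedClique

open Finset

/-- Within one residue class, `c` is determined by its quotient by `n`, which takes fewer than `K +
1` values. All dealing out of objects modulo `n` or `s` is balanced for this reason. -/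
theorem card_filter_mod_le {α : Type*} {A : Finset α} {c : α → ℕ} {n K : ℕ} (hn : 0 < n)
    (hc : ∀ a ∈ A, c a < K * n) (hinj : Set.InjOn c A) (y : ℕ) : #{a ∈ A | c a % n = y} ≤ K := by
  rw [← card_range K]
  refine card_le_card_of_injOn (fun a => c a / n) ?_ ?_
  · intro a ha
    simp only [mem_coe, mem_filter] at ha
    simpa using (Nat.div_lt_iff_lt_mul hn).2 (hc a ha.1)
  · intro a ha b hb h
    simp only [mem_coe, mem_filter] at ha hb
    apply hinj ha.1 hb.1
    rw [← Nat.div_add_mod (c a) n, ← Nat.div_add_mod (c b) n, ha.2, hb.2]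
    simp only at h
    rw [h]

section Combinatorics

variable {α L R : Type*} [DecidableEq α] [DecidableEq L] [DecidableEq R]

/-- Greedy edge colouring of a bipartite multigraph with maximum degree `N`. -/
theorem exists_edgeColoring (A : Finset α) (f : α → L) (g : α → R) (N : ℕ)
    (hf : ∀ l, #{a ∈ A | f a = l} ≤ N) (hg : ∀ r, #{a ∈ A | g a = r} ≤ N) :
    ∃ c : α → ℕ, (∀ a ∈ A, c a < 2 * N) ∧
      ∀ a ∈ A, ∀ b ∈ A, (f a = f b ∨ g a = g b) → c a = c b → a = b := by
  induction A using Finset.induction_on with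
  | empty => exact ⟨fun _ => 0, by simp, by simp⟩
  | insert x A hx ih =>
    obtain ⟨c, hc, hinj⟩ := ih
      (fun l => (card_le_card (filter_subset_filter _ (subset_insert _ _))).trans (hf l))
      (fun r => (card_le_card (filter_subset_filter _ (subset_insert _ _))).trans (hg r))
    have h1 : #{a ∈ A | f a = f x} + 1 ≤ N := by
      have := hf (f x)
      rwa [filter_insert, if_pos rfl, card_insert_of_notMem (by simp [hx])] at this
    have h2 : #{a ∈ A | g a = g x} + 1 ≤ N := by
      have := hg (g x)
      rwa [filter_insert, if_pos rfl, card_insert_of_notMem (by simp [hx])] at this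
    -- At either end of `x` at most `N - 1` other edges are coloured, so fewer than `2 * N` colours
    -- are forbidden.
    have h3 : #({a ∈ A | f a = f x ∨ g a = g x}.image c) < #(range (2 * N)) := by
      rw [card_range]
      calc _ ≤ #{a ∈ A | f a = f x ∨ g a = g x} := card_image_le
        _ ≤ #{a ∈ A | f a = f x} + #{a ∈ A | g a = g x} := by
          rw [filter_or]; exact card_union_le _ _
        _ < 2 * N := by omega
    obtain ⟨z, hz, hz'⟩ := exists_mem_notMem_of_card_lt_card h3
    have hne : ∀ a ∈ A, (f a = f x ∨ g a = g x) → c a ≠ z := by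
      intro a ha h e
      exact hz' (mem_image.2 ⟨a, by simp [ha, h], e⟩)
    have hax : ∀ a ∈ A, a ≠ x := fun a ha e => hx (e ▸ ha)
    refine ⟨Function.update c x z, ?_, ?_⟩
    · intro a ha
      rcases mem_insert.1 ha with rfl | ha
      · simpa using hz
      · rw [Function.update_of_ne (hax a ha)]; exact hc a ha
    · intro a ha b hb h e
      rcases mem_insert.1 ha with hax' | ha <;> rcases mem_insert.1 hb with hbx | hb
      · rw [hax', hbx]
      · rw [hax', Function.update_self, Function.update_of_ne (hax b hb)] at e
        rw [hax'] at h
        exact absurd e.symm (hne b hb (h.imp Eq.symm Eq.symm))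
      · rw [hbx, Function.update_self, Function.update_of_ne (hax a ha)] at e
        rw [hbx] at h
        exact absurd e (hne a ha h)
      · rw [Function.update_of_ne (hax a ha), Function.update_of_ne (hax b hb)] at e
        exact hinj a ha b hb h e

/-- Messages with bounded loads at sources and destinations can be assigned to relays such that
all loads of links are bounded. -/
theorem exists_relay {n : ℕ} (hn : 0 < n) (A : Finset α) (f : α → L) (g : α → R) (K : ℕ)
    (hf : ∀ l, #{a ∈ A | f a = l} ≤ K * n) (hg : ∀ r, #{a ∈ A | g a = r} ≤ K * n) :
    ∃ ρ : α → Fin n, (∀ l y, #{a ∈ A | f a = l ∧ ρ a = y} ≤ 2 * K) ∧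
      (∀ r y, #{a ∈ A | ρ a = y ∧ g a = r} ≤ 2 * K) := by
  obtain ⟨c, hc, hinj⟩ := exists_edgeColoring A f g (K * n) hf hg
  -- Each colour occurs at most once per source and once per destination. Folding the `2 * (K * n)`
  -- colours modulo `n` leaves `2 * K` colours for every relay.
  refine ⟨fun a => ⟨c a % n, Nat.mod_lt _ hn⟩, ?_, ?_⟩
  · intro l y
    have := card_filter_mod_le (A := {a ∈ A | f a = l}) (c := c) (K := 2 * K) hn
      (fun a ha => by have := hc a (mem_filter.1 ha).1; linarith) (by
        intro a ha b hb h
        simp only [mem_coe, mem_filter] at ha hb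
        exact hinj a ha.1 b hb.1 (Or.inl (ha.2.trans hb.2.symm)) h) y
    simpa only [filter_filter, Fin.ext_iff] using this
  · intro r y
    have := card_filter_mod_le (A := {a ∈ A | g a = r}) (c := c) (K := 2 * K) hn
      (fun a ha => by have := hc a (mem_filter.1 ha).1; linarith) (by
        intro a ha b hb h
        simp only [mem_coe, mem_filter] at ha hb
        exact hinj a ha.1 b hb.1 (Or.inr (ha.2.trans hb.2.symm)) h) y
    simpa only [filter_filter, Fin.ext_iff, and_comm] using this

/-- The position of `a` in a fixed enumeration of the finite set `s`. -/
noncomputable def rank (s : Finset α) (a : α) : ℕ :=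
  if h : a ∈ s then s.equivFin ⟨a, h⟩ else 0

theorem rank_lt {s : Finset α} {a : α} (h : a ∈ s) : rank s a < #s := by
  simp [rank, h]

theorem rank_injOn (s : Finset α) : Set.InjOn (rank s) s := by
  intro a ha b hb h
  simp only [mem_coe] at ha hb
  simp only [rank, ha, hb, dif_pos] at h
  have := s.equivFin.injective (Fin.ext h)
  simpa using this

theorem card_filter_rank_div_le (s : Finset α) {n : ℕ} (hn : 0 < n) (q : ℕ) :
    #{a ∈ s | rank s a / n = q} ≤ n := by
  conv_rhs => rw [← card_range n]
  refine card_le_card_of_injOn (fun a => rank s a % n) ?_ ?_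
  · intro a _
    simpa using Nat.mod_lt _ hn
  · intro a ha b hb h
    simp only [mem_coe, mem_filter] at ha hb
    apply rank_injOn s ha.1 hb.1
    rw [← Nat.div_add_mod (rank s a) n, ← Nat.div_add_mod (rank s b) n, ha.2, hb.2]
    simp only at h
    rw [h]

theorem card_filter_rank_mod_le {s : Finset α} {n K : ℕ} (hn : 0 < n) (hs : #s ≤ K * n) (y : ℕ) :
    #{a ∈ s | rank s a % n = y} ≤ K :=
  card_filter_mod_le hn (fun _ ha => (rank_lt ha).trans_le hs) (rank_injOn s) y

end Combinatorics

variable {n B t : ℕ} {X Y Z : Type} {Msg : Type} [Fintype Msg] [DecidableEq Msg]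

/-- Two rounds in which every message of the set `A G` moves from its location `loc G` to its
new location `loc' G` via the relay `ρ G`. -/
theorem Knows.relay {f : SimpleGraph (Fin n) → Fin n → X} (hn : 2 ≤ n) (a K : ℕ)
    (hMsg : Fintype.card Msg ≤ n ^ a) (hB : (2 * a + 1) * K * Nat.log 2 n ≤ B)
    (A : SimpleGraph (Fin n) → Finset Msg) (loc : SimpleGraph (Fin n) → Msg → Fin n)
    (dst : Msg → Fin n) (ρ : SimpleGraph (Fin n) → Msg → Fin n)
    (hK : ∀ G u v, #{m ∈ A G | loc G m = u ∧ ρ G m = v} ≤ K)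
    (hK' : ∀ G u v, #{m ∈ A G | ρ G m = u ∧ dst m = v} ≤ K)
    (hf : Knows B t f) (hA : Determines f fun G v => {m ∈ A G | loc G m = v})
    (hρ : ∀ G G' v, f G v = f G' v → ∀ m ∈ A G, loc G m = v → ρ G m = ρ G' m) :
    Knows B (t + 2) fun G v => (f G v, {m ∈ A G | dst m = v}) := by
  have h1 := hf.forward hn a K hMsg hB A loc ρ hK hA hρ
  have h2 := h1.forward hn a K hMsg hB A ρ (fun _ => dst) hK' determines_snd
    (fun _ _ _ _ _ _ _ => rfl)
  have : Nonempty X := by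
    obtain ⟨A, hA⟩ := hf
    exact ⟨f ⊥ ⟨0, by omega⟩⟩
  exact h2.mono ((determines_fst.trans determines_fst).prodMk determines_snd)

end CongestedClique

/-! ### Broadcasts inside groups, and slots of a count matrix. -/

namespace CongestedClique

open Finset

theorem card_mod_eq_le {n s : ℕ} (hs : 0 < s) (hsn' : n ≤ 4 * s * s) (i : ℕ) :
    #{v : Fin n | (v : ℕ) % s = i} ≤ 4 * s :=
  card_filter_mod_le hs (fun v _ => v.2.trans_le hsn') (fun _ _ _ _ h => Fin.ext h) i

theorem mod_add_mul_mod_lt {n s : ℕ} (hs : 0 < s) (hsn : s * s ≤ n) (v w : ℕ) :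
    v % s + s * (w % s) < n := by
  have h2 := Nat.mod_lt v hs
  have h3 := Nat.mod_lt w hs
  nlinarith

variable {n B t : ℕ} {X Y Z : Type}

/-- The nodes are divided into `s` groups by their residues modulo `s`, where `s`
has the order of `√n`. In two rounds, every node can tell `4 * s` words to all nodes of its
group. -/
theorem Knows.groupBroadcast {f : SimpleGraph (Fin n) → Fin n → X} (hn : 2 ≤ n) {s : ℕ} (hs : 0 < s)
    (hsn : s * s ≤ n) (hsn' : n ≤ 4 * s * s) (N b : ℕ) (hN : N + 1 ≤ n ^ b) (hB : (2 * (b + 5) + 1) * 32 * Nat.log 2 n ≤ B)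
    (hf : Knows B t f) {x : SimpleGraph (Fin n) → Fin n → Fin (4 * s) → ℕ}
    (hx : Determines f x) (hxN : ∀ G v i, x G v i ≤ N) :
    Knows B (t + 2) fun G v => (f G v, fun (u : Fin n) i =>
      if (u : ℕ) % s = v % s then x G u i else 0) := by
  classical
  -- The pattern of triples (sender, word index, receiver) does not depend on `G`, so its relays are
  -- fixed in advance and need no communication.
  let P : Finset (Fin n × Fin (4 * s) × Fin n) := {p | (p.1 : ℕ) % s = p.2.2 % s}
  obtain ⟨ρ, hρ1, hρ2⟩ := exists_relay (n := n) (by omega) P (fun p => p.1) (fun p => p.2.2) 16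
    (by
      intro u
      calc _ ≤ #((univ : Finset (Fin (4 * s))) ×ˢ
              ({v : Fin n | (v : ℕ) % s = u % s} : Finset (Fin n))) := by
            refine card_le_card_of_injOn (fun p => p.2) ?_ ?_
            · intro p hp
              simp only [P, mem_coe, mem_filter, mem_univ, true_and] at hp
              simp [← hp.1, ← hp.2]
            · intro p hp p' hp' h
              simp only [mem_coe, mem_filter] at hp hp'
              exact Prod.ext (hp.2.trans hp'.2.symm) h
        _ ≤ 4 * s * (4 * s) := by
            rw [card_product, card_univ, Fintype.card_fin]
            exact Nat.mul_le_mul_left _ (card_mod_eq_le hs hsn' _)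
        _ ≤ 16 * n := by nlinarith)
    (by
      intro u
      calc _ ≤ #(({v : Fin n | (v : ℕ) % s = u % s} : Finset (Fin n)) ×ˢ
              (univ : Finset (Fin (4 * s)))) := by
            refine card_le_card_of_injOn (fun p => (p.1, p.2.1)) ?_ ?_
            · intro p hp
              simp only [P, mem_coe, mem_filter, mem_univ, true_and] at hp
              simp [hp.1, ← hp.2]
            · intro p hp p' hp' h
              simp only [mem_coe, mem_filter] at hp hp'
              simp only [Prod.mk.injEq] at h
              exact Prod.ext h.1 (Prod.ext h.2 (hp.2.trans hp'.2.symm))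
        _ ≤ 4 * s * (4 * s) := by
            rw [card_product, card_univ, Fintype.card_fin]
            exact Nat.mul_le_mul_right _ (card_mod_eq_le hs hsn' _)
        _ ≤ 16 * n := by nlinarith)
  let A : SimpleGraph (Fin n) → Finset ((Fin n × Fin (4 * s) × Fin n) × Fin (N + 1)) :=
    fun G => {m | m.1 ∈ P ∧ (m.2 : ℕ) = x G m.1.1 m.1.2.1}
  have hinj : ∀ G (Q : Fin n × Fin (4 * s) × Fin n → Prop) [DecidablePred Q],
      #{m ∈ A G | Q m.1} ≤ #{p ∈ P | Q p} := by
    intro G Q _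
    refine card_le_card_of_injOn Prod.fst ?_ ?_
    · intro m hm
      simp only [A, mem_coe, mem_filter, mem_univ, true_and] at hm ⊢
      exact ⟨hm.1.1, hm.2⟩
    · intro m hm m' hm' h
      simp only [A, mem_coe, mem_filter, mem_univ, true_and] at hm hm'
      exact Prod.ext h (Fin.ext (by rw [hm.1.2, hm'.1.2, h]))
  have hcard : Fintype.card ((Fin n × Fin (4 * s) × Fin n) × Fin (N + 1)) ≤ n ^ (b + 5) := by
    simp only [Fintype.card_prod, Fintype.card_fin]
    have h4 : 4 * s ≤ n ^ 3 := by
      have : s ≤ n := by nlinarith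
      have : 2 * 2 ≤ n * n := Nat.mul_le_mul hn hn
      calc 4 * s ≤ n * n * n := Nat.mul_le_mul (by omega) (by omega)
        _ = n ^ 3 := by ring
    calc n * (4 * s * n) * (N + 1) ≤ n * (n ^ 3 * n) * n ^ b := by gcongr
      _ = n ^ (b + 5) := by ring
  have h := hf.relay hn (b + 5) 32 hcard hB A (fun _ m => m.1.1) (fun m => m.1.2.2)
    (fun _ m => ρ m.1) (fun G u v => (hinj G fun p => p.1 = u ∧ ρ p = v).trans (hρ1 u v))
    (fun G u v => (hinj G fun p => ρ p = u ∧ p.2.2 = v).trans (hρ2 v u)) (by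
      intro G G' v h
      have h' := hx G G' v h
      ext m
      simp only [A, mem_filter, mem_univ, true_and]
      constructor
      · rintro ⟨⟨h1, h2⟩, h3⟩
        rw [h3, h'] at h2
        exact ⟨⟨h1, by rw [h3, h2]⟩, h3⟩
      · rintro ⟨⟨h1, h2⟩, h3⟩
        rw [h3, ← h'] at h2
        exact ⟨⟨h1, by rw [h3, h2]⟩, h3⟩) (fun _ _ _ _ _ _ _ => rfl)
  have : Nonempty X := by
    obtain ⟨A, hA⟩ := hf
    exact ⟨f ⊥ ⟨0, by omega⟩⟩
  refine h.mono (determines_fst.prodMk ?_)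
  intro G G' v h
  have h2 := congrArg Prod.snd h
  funext u i
  dsimp only at h2 ⊢
  split_ifs with huv
  · have h3 : (((u, i, v), ⟨x G u i, Nat.lt_succ_of_le (hxN G u i)⟩) :
        (Fin n × Fin (4 * s) × Fin n) × Fin (N + 1)) ∈ {m ∈ A G | m.1.2.2 = v} := by
      simp [A, P, huv]
    rw [h2] at h3
    simp only [A, mem_filter, mem_univ, true_and] at h3
    exact h3.1.2
  · rfl

/-- For a matrix `c` of multiplicities, the positions of single objects. -/
def slots {J : Type} [Fintype J] [DecidableEq J] (c : Fin n → J → ℕ) : Finset (Fin n × J × ℕ) :=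
  (univ : Finset (Fin n × J)).biUnion fun p => (range (c p.1 p.2)).image fun τ => (p.1, p.2, τ)

section Slots

variable {J : Type} [Fintype J] [DecidableEq J]

theorem mem_slots {c : Fin n → J → ℕ} {x : Fin n × J × ℕ} :
    x ∈ slots c ↔ x.2.2 < c x.1 x.2.1 := by
  obtain ⟨h, j, τ⟩ := x
  simp only [slots, mem_biUnion, mem_univ, true_and, mem_image, mem_range, Prod.mk.injEq,
    Prod.exists]
  constructor
  · rintro ⟨_, _, _, h1, rfl, rfl, rfl⟩; exact h1
  · intro h1; exact ⟨_, _, _, h1, rfl, rfl, rfl⟩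

theorem card_slots_row_le (c : Fin n → J → ℕ) (h : Fin n) :
    #{x ∈ slots c | x.1 = h} ≤ ∑ j, c h j := by
  have : {x ∈ slots c | x.1 = h} ⊆ univ.biUnion fun j => (range (c h j)).image fun τ => (h, j, τ) := by
    rintro ⟨h', j, τ⟩ hx
    simp only [mem_filter, mem_slots] at hx
    obtain ⟨hx, rfl⟩ := hx
    simpa using hx
  refine (card_le_card this).trans (card_biUnion_le.trans (sum_le_sum fun j _ => ?_))
  exact card_image_le.trans (by simp)

theorem card_slots_col_le (c : Fin n → J → ℕ) (j : J) :
    #{x ∈ slots c | x.2.1 = j} ≤ ∑ h, c h j := by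
  have : {x ∈ slots c | x.2.1 = j} ⊆
      univ.biUnion fun h => (range (c h j)).image fun τ => (h, j, τ) := by
    rintro ⟨h', j, τ⟩ hx
    simp only [mem_filter, mem_slots] at hx
    obtain ⟨hx, rfl⟩ := hx
    simpa using hx
  refine (card_le_card this).trans (card_biUnion_le.trans (sum_le_sum fun j _ => ?_))
  exact card_image_le.trans (by simp)

/-- Columns may be far heavier than rows, so each column is cut into pieces of at most `n` slots
before colouring. Every piece contributes `2 * K` to a relay, which gives the factor counting
pieces. The relay map depends on the matrix `c` alone. -/
theorem exists_slot_relay (hn : 0 < n) {K : ℕ} (hK : 1 ≤ K) (c : Fin n → J → ℕ)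
    (hc : ∀ h, ∑ j, c h j ≤ K * n) :
    ∃ ρ : Fin n × J × ℕ → Fin n, (∀ h y, #{x ∈ slots c | x.1 = h ∧ ρ x = y} ≤ 2 * K) ∧
      ∀ j y, #{x ∈ slots c | ρ x = y ∧ x.2.1 = j} ≤ ((∑ h, c h j) / n + 1) * (2 * K) := by
  let κ : Fin n × J × ℕ → ℕ := fun x => rank {x' ∈ slots c | x'.2.1 = x.2.1} x / n
  obtain ⟨ρ, h1, h2⟩ := exists_relay hn (slots c) (fun x => x.1) (fun x => (x.2.1, κ x)) K
    (fun h => (card_slots_row_le c h).trans (hc h)) (by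
      rintro ⟨j, q⟩
      refine le_trans (card_le_card ?_) ((card_filter_rank_div_le {x ∈ slots c | x.2.1 = j} hn q).trans
        (by nlinarith))
      intro x hx
      simp only [mem_filter, Prod.mk.injEq] at hx ⊢
      obtain ⟨hx, rfl, h⟩ := hx
      exact ⟨⟨hx, rfl⟩, h⟩)
  refine ⟨ρ, h1, fun j y => ?_⟩
  have hsub : {x ∈ slots c | ρ x = y ∧ x.2.1 = j} ⊆ (range ((∑ h, c h j) / n + 1)).biUnion
      fun q => {x ∈ slots c | ρ x = y ∧ (x.2.1, κ x) = (j, q)} := by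
    intro x hx
    simp only [mem_filter] at hx
    simp only [mem_biUnion, mem_range, mem_filter, Prod.mk.injEq]
    refine ⟨κ x, ?_, hx.1, hx.2.1, hx.2.2, rfl⟩
    rw [Nat.lt_succ_iff]
    apply Nat.div_le_div_right
    refine (rank_lt (by simp [hx.1])).le.trans ?_
    rw [hx.2.2]
    exact card_slots_col_le c j
  refine (card_le_card hsub).trans (card_biUnion_le.trans ?_)
  refine (sum_le_sum fun q _ => h2 (j, q) y).trans ?_
  simp

end Slots

end CongestedClique

/-! ### Deterministic routing. -/

namespace CongestedClique

open Finset

section GroupCount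

variable {n s : ℕ} {α J : Type} [DecidableEq J]

/-- The slot of the object `m` among those of its location `loc m` and class `cls m`. -/
noncomputable def slotOf [DecidableEq α] (A : Finset α) (loc : α → Fin n) (cls : α → J) (m : α) : Fin n × J × ℕ :=
  (loc m, cls m, rank {m' ∈ A | loc m' = loc m ∧ cls m' = cls m} m)

/-- The numbers of objects by location and class, for the locations in the `i`-th group. -/
def groupCount (s : ℕ) (A : Finset α) (loc : α → Fin n) (cls : α → J) (i : ℕ) (u : Fin n) (j : J) :
    ℕ :=
  if (u : ℕ) % s = i then #{m ∈ A | loc m = u ∧ cls m = j} else 0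

variable {A A' : Finset α} {loc loc' : α → Fin n} {cls : α → J}

theorem slotOf_injOn [DecidableEq α] : Set.InjOn (slotOf A loc cls) A := by
  intro m hm m' hm' h
  simp only [slotOf, Prod.mk.injEq] at h
  obtain ⟨h1, h2, h3⟩ := h
  rw [← h1, ← h2] at h3
  exact rank_injOn _ (by simpa using hm) (by simpa [h1, h2] using hm') h3

theorem slotOf_mem_slots [DecidableEq α] [Fintype J] {m : α} (hm : m ∈ A) {i : ℕ} (hi : (loc m : ℕ) % s = i) :
    slotOf A loc cls m ∈ slots (groupCount s A loc cls i) := by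
  rw [mem_slots]
  change _ < if _ then _ else _
  rw [if_pos (by exact hi)]
  exact rank_lt (by simp [hm])

theorem sum_groupCount_row_le [Fintype J] (i : ℕ) (u : Fin n) :
    ∑ j, groupCount s A loc cls i u j ≤ #{m ∈ A | loc m = u} := by
  calc _ ≤ ∑ j, #{m ∈ {m ∈ A | loc m = u} | cls m = j} := by
        refine sum_le_sum fun j _ => ?_
        rw [filter_filter, groupCount]
        split_ifs <;> simp
    _ = _ := (card_eq_sum_card_fiberwise (by simp)).symm

theorem sum_groupCount_col_le (i : ℕ) (j : J) :
    ∑ u, groupCount s A loc cls i u j ≤ #{m ∈ A | (loc m : ℕ) % s = i ∧ cls m = j} := by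
  calc _ ≤ ∑ u, #{m ∈ {m ∈ A | (loc m : ℕ) % s = i ∧ cls m = j} | loc m = u} := by
        refine sum_le_sum fun u _ => ?_
        rw [filter_filter, groupCount]
        split_ifs with h
        · refine card_le_card fun m hm => ?_
          simp only [mem_filter] at hm ⊢
          obtain ⟨h1, rfl, h2⟩ := hm
          exact ⟨h1, ⟨h, h2⟩, rfl⟩
        · simp
    _ = _ := (card_eq_sum_card_fiberwise (by simp)).symm

/-- The slot of a message is computable at its present location: its rank is taken only among
messages at that same location. -/
theorem filter_class_congr {v : Fin n} (h : {m ∈ A | loc m = v} = {m ∈ A' | loc' m = v}) {m : α}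
    (hm : m ∈ A) (hv : loc m = v) : loc' m = v ∧
      {m' ∈ A | loc m' = loc m ∧ cls m' = cls m} = {m' ∈ A' | loc' m' = loc' m ∧ cls m' = cls m} := by
  have h1 : loc' m = v := by
    have : m ∈ {m ∈ A' | loc' m = v} := h ▸ (by simp [hm, hv])
    exact (mem_filter.1 this).2
  refine ⟨h1, ?_⟩
  rw [hv, h1, ← filter_filter, h, filter_filter]

theorem slotOf_congr [DecidableEq α] {v : Fin n} (h : {m ∈ A | loc m = v} = {m ∈ A' | loc' m = v}) {m : α}
    (hm : m ∈ A) (hv : loc m = v) : slotOf A loc cls m = slotOf A' loc' cls m := by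
  obtain ⟨h1, h2⟩ := filter_class_congr (cls := cls) h hm hv
  rw [slotOf, slotOf, h2, hv, h1]

end GroupCount

variable {n B t : ℕ} {X Y Z : Type} {Msg : Type} [Fintype Msg] [DecidableEq Msg]

theorem succ_mul_le_pow (hn : 2 ≤ n) (K : ℕ) : K * n + 1 ≤ n ^ (K + 1) := by
  have h : K + 1 ≤ n ^ K := (Nat.lt_two_pow_self).trans_le (Nat.pow_le_pow_left hn K)
  calc K * n + 1 ≤ (K + 1) * n := by nlinarith
    _ ≤ n ^ K * n := by gcongr
    _ = _ := (pow_succ _ _).symm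

/-- The bandwidth, in words, that suffices for the routing of messages of `a` words with
loads of at most `K * n` at all sources and destinations. -/
def routingBandwidth (a K : ℕ) : ℕ :=
  (2 * (a + (2 * K * (4 * K + 1) + 6)) + 1) * (2 * (2 * K * (4 * K + 1)) + 32)

theorem le_routingBandwidth {a K a' K' B L : ℕ} (hB : routingBandwidth a K * L ≤ B)
    (ha : a' ≤ a + (2 * K * (4 * K + 1) + 6)) (hK : K' ≤ 2 * (2 * K * (4 * K + 1)) + 32) :
    (2 * a' + 1) * K' * L ≤ B := by
  refine le_trans ?_ hB
  unfold routingBandwidth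
  gcongr

/-- Deterministic routing (Lenzen): if every node is the source of at most `K * n` messages and
the destination of at most `K * n` messages, then all messages can be delivered in eight rounds. -/
theorem Knows.route {f : SimpleGraph (Fin n) → Fin n → X} (hn : 2 ≤ n) (a K : ℕ) (hK1 : 1 ≤ K)
    (hMsg : Fintype.card Msg ≤ n ^ a) (hB : routingBandwidth a K * Nat.log 2 n ≤ B)
    (A : SimpleGraph (Fin n) → Finset Msg) (src dst : Msg → Fin n)
    (hsrc : ∀ G v, #{m ∈ A G | src m = v} ≤ K * n) (hdst : ∀ G v, #{m ∈ A G | dst m = v} ≤ K * n)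
    (hf : Knows B t f) (hA : Determines f fun G v => {m ∈ A G | src m = v}) :
    Knows B (t + 8) fun G v => (f G v, {m ∈ A G | dst m = v}) := by
  -- `s = ⌊√n⌋`: residues modulo `s` give groups with at most `4 * s` members, and `s * s` nodes are
  -- certain to exist.
  obtain ⟨s, hs, hsn, hsn'⟩ : ∃ s, 0 < s ∧ s * s ≤ n ∧ n ≤ 4 * s * s := by
    have h1 : 0 < Nat.sqrt n := Nat.sqrt_pos.2 (by omega)
    have h2 := Nat.lt_succ_sqrt n
    have h4 : (Nat.sqrt n + 1) * (Nat.sqrt n + 1) ≤ 4 * Nat.sqrt n * Nat.sqrt n := by nlinarith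
    simp only [Nat.succ_eq_add_one] at h2
    exact ⟨_, h1, Nat.sqrt_le n, by omega⟩
  have hn0 : 0 < n := by omega
  obtain ⟨K2, hK2⟩ : ∃ K2, K2 = 2 * K * (4 * K + 1) := ⟨_, rfl⟩
  have hbw : ∀ a' K', a' ≤ a + (K2 + 6) → K' ≤ 2 * K2 + 32 →
      (2 * a' + 1) * K' * Nat.log 2 n ≤ B := by
    rw [hK2]
    exact fun a' K' => le_routingBandwidth hB
  have hKK2 : K ≤ K2 := by nlinarith
  -- `grp` and `idx` are remainder and quotient of the destination by `s`. The remainder is below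
  -- `s`, but both get the type `Fin (4 * s)` of the word index in `Knows.groupBroadcast`.
  let grp : Msg → Fin (4 * s) := fun m => ⟨dst m % s, (Nat.mod_lt _ hs).trans_le (by omega)⟩
  let idx : Msg → Fin (4 * s) := fun m =>
    ⟨dst m / s, (Nat.div_lt_iff_lt_mul hs).2 ((dst m).2.trans_le hsn')⟩
  -- balancing with respect to the groups of the destinations
  have hR1 : ∀ c : Fin n → Fin (4 * s) → ℕ, ∃ ρ : Fin n × Fin (4 * s) × ℕ → Fin n,
      (∀ h, ∑ j, c h j ≤ K * n) →
        (∀ h y, #{x ∈ slots c | x.1 = h ∧ ρ x = y} ≤ 2 * K) ∧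
        ∀ j y, #{x ∈ slots c | ρ x = y ∧ x.2.1 = j} ≤ ((∑ h, c h j) / n + 1) * (2 * K) := by
    intro c
    by_cases h : ∀ h, ∑ j, c h j ≤ K * n
    · obtain ⟨ρ, h1⟩ := exists_slot_relay hn0 hK1 c h
      exact ⟨ρ, fun _ => h1⟩
    · exact ⟨fun _ => ⟨0, hn0⟩, fun h' => absurd h' h⟩
  -- The plan must be a function of the count matrix alone, so that all members of a source group
  -- agree on it. Hence it is chosen for every matrix, with a dummy value where the row bound fails.
  choose R1 hR1 using hR1
  let C1 : SimpleGraph (Fin n) → ℕ → Fin n → Fin (4 * s) → ℕ :=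
    fun G i => groupCount s (A G) src grp i
  have hC1row : ∀ G i u, ∑ j, C1 G i u j ≤ K * n :=
    fun G i u => (sum_groupCount_row_le i u).trans (hsrc G u)
  let ρ1 : SimpleGraph (Fin n) → Msg → Fin n :=
    fun G m => R1 (C1 G (src m % s)) (slotOf (A G) src grp m)
  have hlink1 : ∀ G u y, #{m ∈ A G | src m = u ∧ ρ1 G m = y} ≤ 2 * K := by
    intro G u y
    refine (card_le_card_of_injOn (slotOf (A G) src grp) ?_ ?_).trans
      ((hR1 (C1 G (u % s)) (hC1row G _)).1 u y)
    · intro m hm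
      simp only [mem_coe, mem_filter] at hm ⊢
      obtain ⟨h1, rfl, h2⟩ := hm
      exact ⟨slotOf_mem_slots h1 rfl, rfl, h2⟩
    · exact slotOf_injOn.mono fun m hm => (mem_filter.1 hm).1
  have hgrp1 : ∀ G y j, #{m ∈ A G | ρ1 G m = y ∧ grp m = j} ≤ K2 * s := by
    intro G y j
    have h1 : #{m ∈ A G | grp m = j} ≤ 4 * s * (K * n) := by
      calc _ = ∑ v ∈ {v : Fin n | (v : ℕ) % s = j}, #{m ∈ {m ∈ A G | grp m = j} | dst m = v} := by
            refine card_eq_sum_card_fiberwise fun m hm => ?_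
            simp only [mem_coe, mem_filter] at hm
            simp [← hm.2, grp]
        _ ≤ ∑ v ∈ {v : Fin n | (v : ℕ) % s = j}, K * n := by
            refine sum_le_sum fun v _ => (card_le_card ?_).trans (hdst G v)
            exact filter_subset_filter _ (filter_subset _ _)
        _ ≤ _ := by
            rw [sum_const, smul_eq_mul]
            exact Nat.mul_le_mul_right _ (card_mod_eq_le hs hsn' _)
    have h2 : ∑ i ∈ range s, (∑ u, C1 G i u j) ≤ #{m ∈ A G | grp m = j} := by
      calc _ ≤ ∑ i ∈ range s, #{m ∈ {m ∈ A G | grp m = j} | (src m : ℕ) % s = i} := by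
            refine sum_le_sum fun i _ => (sum_groupCount_col_le i j).trans (card_le_card ?_)
            intro m hm
            simp only [mem_filter] at hm ⊢
            tauto
        _ = _ := by
            refine (card_eq_sum_card_fiberwise fun m _ => ?_).symm
            simpa using Nat.mod_lt _ hs
    -- Summed over the `s` source groups, the full pieces number at most `4 * s * K` and rounding up
    -- adds `s`; this is the origin of `K2`.
    have h3 : ∑ i ∈ range s, (∑ u, C1 G i u j) / n ≤ 4 * s * K := by
      refine Nat.le_of_mul_le_mul_right ?_ hn0
      rw [sum_mul]
      refine (sum_le_sum fun i _ => Nat.div_mul_le_self _ _).trans (h2.trans (h1.trans (le_of_eq ?_)))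
      ring
    calc _ = ∑ i ∈ range s, #{m ∈ {m ∈ A G | ρ1 G m = y ∧ grp m = j} | (src m : ℕ) % s = i} := by
          refine card_eq_sum_card_fiberwise fun m _ => ?_
          simpa using Nat.mod_lt _ hs
      _ ≤ ∑ i ∈ range s, ((∑ u, C1 G i u j) / n + 1) * (2 * K) := by
          refine sum_le_sum fun i _ => ?_
          refine (card_le_card_of_injOn (slotOf (A G) src grp) ?_ ?_).trans
            ((hR1 (C1 G i) (hC1row G _)).2 j y)
          · intro m hm
            simp only [mem_coe, mem_filter] at hm ⊢
            obtain ⟨⟨h1, h2, h3⟩, h4⟩ := hm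
            refine ⟨slotOf_mem_slots h1 h4, ?_, h3⟩
            simpa only [ρ1, h4] using h2
          · exact slotOf_injOn.mono fun m hm => by
              simp only [mem_coe, mem_filter] at hm
              exact hm.1.1
      _ = (∑ i ∈ range s, (∑ u, C1 G i u j) / n + s) * (2 * K) := by
          rw [← sum_mul, sum_add_distrib]
          simp
      _ ≤ (4 * s * K + s) * (2 * K) := by gcongr
      _ = _ := by rw [hK2]; ring
  -- moving to the groups of the destinations
  let mid : SimpleGraph (Fin n) → Msg → Fin n := fun G m =>
    ⟨dst m % s + s * (rank {m' ∈ A G | ρ1 G m' = ρ1 G m ∧ grp m' = grp m} m % s),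
      mod_add_mul_mod_lt hs hsn _ _⟩
  have hmid_mod : ∀ G m, (mid G m : ℕ) % s = dst m % s := by
    intro G m
    simp only [mid, Nat.add_mul_mod_self_left, Nat.mod_mod]
  have hmid_div : ∀ G m, (mid G m : ℕ) / s =
      rank {m' ∈ A G | ρ1 G m' = ρ1 G m ∧ grp m' = grp m} m % s := by
    intro G m
    simp only [mid]
    rw [Nat.add_mul_div_left _ _ hs, Nat.div_eq_of_lt (Nat.mod_lt _ hs), zero_add]
  -- Node `y` holds at most `K2 * s` messages for a destination group and deals them in turn to `s`
  -- members of it, at most `K2` to each.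
  have hlink2 : ∀ G y z, #{m ∈ A G | ρ1 G m = y ∧ mid G m = z} ≤ K2 := by
    intro G y z
    let j : Fin (4 * s) := ⟨z % s, (Nat.mod_lt _ hs).trans_le (by omega)⟩
    refine (card_le_card ?_).trans
      (card_filter_rank_mod_le (s := {m ∈ A G | ρ1 G m = y ∧ grp m = j}) hs (hgrp1 G y j) (z / s))
    intro m hm
    simp only [mem_filter] at hm ⊢
    obtain ⟨h1, h2, h3⟩ := hm
    have h4 : grp m = j := by
      simp only [grp, j, Fin.mk.injEq]
      rw [← h3, hmid_mod]
    refine ⟨⟨h1, h2, h4⟩, ?_⟩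
    rw [← h3, hmid_div, h2, h4]
  have hmid : ∀ G z, #{m ∈ A G | mid G m = z} ≤ K2 * n := by
    intro G z
    calc _ = ∑ y, #{m ∈ {m ∈ A G | mid G m = z} | ρ1 G m = y} :=
          card_eq_sum_card_fiberwise (by simp)
      _ ≤ ∑ y : Fin n, K2 := by
          refine sum_le_sum fun y _ => (card_le_card fun m hm => ?_).trans (hlink2 G y z)
          simp only [mem_filter] at hm ⊢
          exact ⟨hm.1.1, hm.2, hm.1.2⟩
      _ = K2 * n := by rw [sum_const, card_univ, Fintype.card_fin, smul_eq_mul, mul_comm]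
  -- delivery inside the groups
  have hR2 : ∀ c : Fin n → Fin (4 * s) → ℕ, ∃ ρ : Fin n × Fin (4 * s) × ℕ → Fin n,
      (∀ h, ∑ j, c h j ≤ K2 * n) → (∀ j, ∑ h, c h j ≤ K2 * n) →
        (∀ h y, #{x ∈ slots c | x.1 = h ∧ ρ x = y} ≤ 2 * K2) ∧
        ∀ j y, #{x ∈ slots c | ρ x = y ∧ x.2.1 = j} ≤ 2 * K2 := by
    intro c
    by_cases h : (∀ h, ∑ j, c h j ≤ K2 * n) ∧ (∀ j, ∑ h, c h j ≤ K2 * n)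
    · obtain ⟨ρ, h1⟩ := exists_relay hn0 (slots c) (fun x => x.1) (fun x => x.2.1) K2
        (fun u => (card_slots_row_le c u).trans (h.1 u))
        (fun j => (card_slots_col_le c j).trans (h.2 j))
      exact ⟨ρ, fun _ _ => h1⟩
    · exact ⟨fun _ => ⟨0, hn0⟩, fun h1 h2 => absurd ⟨h1, h2⟩ h⟩
  choose R2 hR2 using hR2
  let C2 : SimpleGraph (Fin n) → ℕ → Fin n → Fin (4 * s) → ℕ :=
    fun G i => groupCount s (A G) (mid G) idx i
  have hC2row : ∀ G i u, ∑ j, C2 G i u j ≤ K2 * n :=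
    fun G i u => (sum_groupCount_row_le i u).trans (hmid G u)
  -- Group and `idx` together determine the destination, so a nonempty column is bounded by the load
  -- of a single destination.
  have hC2col : ∀ G i j, ∑ u, C2 G i u j ≤ K2 * n := by
    intro G i j
    refine (sum_groupCount_col_le i j).trans ?_
    rcases Finset.eq_empty_or_nonempty {m ∈ A G | (mid G m : ℕ) % s = i ∧ idx m = j} with h | ⟨m, hm⟩
    · rw [h]; simp
    · refine (card_le_card ?_).trans ((hdst G (dst m)).trans (Nat.mul_le_mul_right _ hKK2))
      intro m' hm'
      simp only [mem_filter, hmid_mod] at hm hm' ⊢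
      refine ⟨hm'.1, Fin.ext ?_⟩
      have h1 : dst m' / s = dst m / s := by
        have := hm'.2.2.trans hm.2.2.symm
        simpa [idx] using this
      rw [← Nat.div_add_mod (dst m') s, ← Nat.div_add_mod (dst m) s, h1, hm.2.1, hm'.2.1]
  let ρ2 : SimpleGraph (Fin n) → Msg → Fin n :=
    fun G m => R2 (C2 G (mid G m % s)) (slotOf (A G) (mid G) idx m)
  have hlink3 : ∀ G z y, #{m ∈ A G | mid G m = z ∧ ρ2 G m = y} ≤ 2 * K2 := by
    intro G z y
    refine (card_le_card_of_injOn (slotOf (A G) (mid G) idx) ?_ ?_).trans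
      ((hR2 (C2 G (z % s)) (hC2row G _) (hC2col G _)).1 z y)
    · intro m hm
      simp only [mem_coe, mem_filter] at hm ⊢
      obtain ⟨h1, rfl, h2⟩ := hm
      exact ⟨slotOf_mem_slots h1 rfl, rfl, h2⟩
    · exact slotOf_injOn.mono fun m hm => (mem_filter.1 hm).1
  -- The groups colour independently but share relays. They do not interfere: all messages for `v`
  -- are now held in the group of `v`, so only one plan uses the links into `v`.
  have hlink4 : ∀ G y v, #{m ∈ A G | ρ2 G m = y ∧ dst m = v} ≤ 2 * K2 := by
    intro G y v
    refine (card_le_card_of_injOn (slotOf (A G) (mid G) idx) ?_ ?_).trans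
      ((hR2 (C2 G (v % s)) (hC2row G _) (hC2col G _)).2
        ⟨v / s, (Nat.div_lt_iff_lt_mul hs).2 (v.2.trans_le hsn')⟩ y)
    · intro m hm
      simp only [mem_coe, mem_filter] at hm ⊢
      obtain ⟨h1, h2, rfl⟩ := hm
      refine ⟨slotOf_mem_slots h1 (hmid_mod G m), ?_, rfl⟩
      simpa only [ρ2, hmid_mod] using h2
    · exact slotOf_injOn.mono fun m hm => (mem_filter.1 hm).1
  -- the five steps
  have k1 := hf.groupBroadcast hn hs hsn hsn' (K * n) (K + 1) (succ_mul_le_pow hn K)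
    (hbw _ _ (by omega) (by omega))
    (x := fun G v j => #{m ∈ A G | src m = v ∧ grp m = j})
    (by
      have h := hA.map fun _ (S : Finset Msg) j => #{m ∈ S | grp m = j}
      simpa only [filter_filter] using h)
    (fun G v j => (card_le_card fun m hm => by
      simp only [mem_filter] at hm ⊢; tauto).trans (hsrc G v))
  have k2 := k1.forward hn a (2 * K) hMsg (hbw _ _ (by omega) (by omega)) A
    (fun _ => src) ρ1 hlink1 (determines_fst.trans hA) (by
      intro G G' v h m hm hv
      have h1 : C1 G (v % s) = C1 G' (v % s) := congrArg Prod.snd h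
      simp only [ρ1]
      rw [slotOf_congr (hA G G' v (congrArg Prod.fst h)) hm hv, hv, h1])
  have k3 := k2.forward hn a K2 hMsg (hbw _ _ (by omega) (by omega)) A
    ρ1 mid hlink2 determines_snd (by
      intro G G' v h m hm hv
      have h1 := congrArg Prod.snd h
      simp only [mid, Fin.mk.injEq]
      rw [(filter_class_congr (cls := grp) h1 hm hv).2])
  have k4 := k3.groupBroadcast hn hs hsn hsn' (K2 * n) (K2 + 1) (succ_mul_le_pow hn K2)
    (hbw _ _ (by omega) (by omega))
    (x := fun G v j => #{m ∈ A G | mid G m = v ∧ idx m = j})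
    (by
      refine Determines.trans (g := fun G v => {m ∈ A G | mid G m = v}) determines_snd ?_
      have h := (Determines.refl fun G v => {m ∈ A G | mid G m = v}).map
        fun _ (S : Finset Msg) j => #{m ∈ S | idx m = j}
      simpa only [filter_filter] using h)
    (fun G v j => (card_le_card fun m hm => by
      simp only [mem_filter] at hm ⊢; tauto).trans (hmid G v))
  have k5 := k4.relay hn a (2 * K2) hMsg (hbw _ _ (by omega) (by omega)) A
    mid dst ρ2 hlink3 hlink4 (determines_fst.trans determines_snd) (by
      intro G G' v h m hm hv
      have h1 : C2 G (v % s) = C2 G' (v % s) := congrArg Prod.snd h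
      have h2 := congrArg (fun x => x.1.2) h
      have h3 := (filter_class_congr (cls := idx) h2 hm hv).1
      simp only [ρ2]
      rw [slotOf_congr h2 hm hv, hv, h1, h3])
  have : Nonempty X := by
    obtain ⟨A, hA⟩ := hf
    exact ⟨f ⊥ ⟨0, hn0⟩⟩
  exact k5.mono ((determines_fst.trans (determines_fst.trans (determines_fst.trans
    (determines_fst.trans determines_fst)))).prodMk determines_snd)

end CongestedClique

/-! ### Girth, pairs of paths and the Moore bound. -/

namespace CongestedClique

open Finset SimpleGraph

section Girth

variable {V : Type*} {G : SimpleGraph V}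

/-- Two different paths with the same ends give a short cycle. -/
theorem egirth_le_of_isPath {v u : V} {p q : G.Walk v u} (hp : p.IsPath) (hq : q.IsPath)
    (hne : p ≠ q) : G.egirth ≤ (p.length + q.length : ℕ) := by
  classical
  -- `H` is the union of the two paths. It is not acyclic, since it contains two distinct paths with
  -- equal ends, and any cycle in it uses only their edges.
  let H : SimpleGraph V := SimpleGraph.fromEdgeSet {x | x ∈ p.edges ∨ x ∈ q.edges}
  have hH : ∀ x, x ∈ p.edges ∨ x ∈ q.edges → x ∈ H.edgeSet := by
    intro x hx
    rw [SimpleGraph.edgeSet_fromEdgeSet]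
    refine ⟨hx, G.not_isDiag_of_mem_edgeSet ?_⟩
    exact hx.elim (fun h => p.edges_subset_edgeSet h) (fun h => q.edges_subset_edgeSet h)
  have hHG : ∀ x ∈ H.edgeSet, x ∈ p.edges ∨ x ∈ q.edges := by
    intro x hx
    rw [SimpleGraph.edgeSet_fromEdgeSet] at hx
    exact hx.1
  have hnot : ¬ H.IsAcyclic := by
    intro hac
    have := hac.subsingleton_path v u
    have h1 := Subsingleton.elim (α := H.Path v u) ⟨_, hp.transfer (H := H) fun x hx => hH x (Or.inl hx)⟩
      ⟨_, hq.transfer (H := H) fun x hx => hH x (Or.inr hx)⟩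
    have h2 := congrArg (fun w : H.Path v u => w.1.support) h1
    simp only [Walk.support_transfer] at h2
    exact hne (Walk.ext_support h2)
  simp only [IsAcyclic, not_forall, not_not] at hnot
  obtain ⟨a, c, hc⟩ := hnot
  have hcG : ∀ x ∈ c.edges, x ∈ G.edgeSet := fun x hx =>
    (hHG x (c.edges_subset_edgeSet hx)).elim (fun h => p.edges_subset_edgeSet h)
      (fun h => q.edges_subset_edgeSet h)
  have h1 := egirth_le_length (hc.transfer hcG)
  rw [Walk.length_transfer] at h1
  refine h1.trans (Nat.cast_le.2 ?_)
  calc c.length = #c.edges.toFinset := by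
        rw [List.toFinset_card_of_nodup hc.edges_nodup, Walk.length_edges]
    _ ≤ #(p.edges ++ q.edges).toFinset := by
        refine card_le_card fun x hx => ?_
        simp only [List.mem_toFinset, List.mem_append] at hx ⊢
        exact hHG x (c.edges_subset_edgeSet hx)
    _ ≤ _ := (List.toFinset_card_le _).trans (by simp)

/-- A short cycle consists of two short paths with the same ends. -/
theorem exists_isPath_of_egirth_le {r : ℕ} (h : G.egirth ≤ (2 * r : ℕ)) :
    ∃ (v u : V) (p q : G.Walk v u), p.IsPath ∧ q.IsPath ∧ p.length ≤ r ∧ q.length ≤ r ∧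
      ∃ x ∈ p.edges, x ∉ q.edges := by
  have hac : ¬ G.IsAcyclic := by
    intro hac
    rw [egirth_eq_top.2 hac, top_le_iff] at h
    exact ENat.natCast_ne_top _ h
  obtain ⟨a, c, hc, hlen⟩ := exists_egirth_eq_length.2 hac
  rw [hlen, Nat.cast_le] at h
  have h3 := hc.three_le_length
  have hi1 : c.length / 2 < c.length := by omega
  -- A shortest cycle is cut at its middle; rounding leaves both halves at most `r`. A cycle repeats
  -- no edge, so the first half has an edge outside the second.
  refine ⟨a, _, c.take (c.length / 2), (c.drop (c.length / 2)).reverse, hc.isPath_take hi1,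
    (hc.isPath_drop (by omega)).reverse, ?_, ?_, ?_⟩
  · rw [Walk.take_length]; omega
  · rw [Walk.length_reverse, Walk.drop_length]; omega
  · have hnd := hc.edges_nodup
    rw [← List.take_append_drop (c.length / 2) c.edges, ← Walk.edges_take, ← Walk.edges_drop,
      List.nodup_append] at hnd
    have hne : (c.take (c.length / 2)).edges ≠ [] := by
      intro h0
      have := congrArg List.length h0
      rw [Walk.length_edges, Walk.take_length, List.length_nil] at this
      omega
    obtain ⟨x, hx⟩ := List.exists_mem_of_ne_nil _ hne
    refine ⟨x, hx, fun hx' => ?_⟩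
    rw [Walk.edges_reverse, List.mem_reverse] at hx'
    exact hnd.2.2 x hx x hx' rfl

open Classical in
/-- Growth of the balls around a vertex of a graph with large girth and minimum degree. -/
theorem pow_le_card_of_lt_egirth [Fintype V] {W : Finset V} {v : V} (hv : v ∈ W) {D R : ℕ}
    (hD : ∀ x ∈ W, D + 1 ≤ #{y ∈ W | G.Adj x y}) (hR : ((2 * R : ℕ) : ℕ∞) < G.egirth) :
    D ^ R ≤ Fintype.card V := by
  let S : ℕ → Finset V := fun j => {u ∈ W | ∃ p : G.Walk v u, p.IsPath ∧ p.length = j}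
  have key : ∀ j ≤ R, D ^ j ≤ #(S j) := by
    intro j
    induction j with
    | zero =>
      intro _
      rw [pow_zero, Nat.one_le_iff_ne_zero, ← Nat.pos_iff_ne_zero, card_pos]
      exact ⟨v, mem_filter.2 ⟨hv, Walk.nil, Walk.IsPath.nil, rfl⟩⟩
    | succ j ih =>
      intro hj
      have hS : ∀ x : S j, ∃ p : G.Walk v x, p.IsPath ∧ p.length = j :=
        fun x => (mem_filter.1 x.2).2
      choose P hP hPlen using hS
      have hSW : ∀ x : S j, x.1 ∈ W := fun x => (mem_filter.1 x.2).1
      let C : S j → Finset V := fun x => {y ∈ W | G.Adj x y ∧ y ≠ (P x).penultimate}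
      have hC : ∀ x, D ≤ #(C x) := by
        intro x
        have h1 := hD x (hSW x)
        have h2 : {y ∈ W | G.Adj x y} ⊆ insert (P x).penultimate (C x) := by
          intro y hy
          simp only [mem_filter, mem_insert, C] at hy ⊢
          tauto
        have h3 := (card_le_card h2).trans (card_insert_le _ _)
        omega
      -- A neighbour of `x` on `P x`, other than its penultimate vertex, would close a cycle of
      -- length at most `j + 1`.
      have hsupp : ∀ x, ∀ y ∈ C x, y ∉ (P x).support := by
        intro x y hy hys
        simp only [C, mem_filter] at hy
        obtain ⟨-, hadj, hpen⟩ := hy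
        have h1 : ((P x).dropUntil y hys).IsPath := (hP x).dropUntil hys
        have h2 : (Walk.cons hadj.symm Walk.nil : G.Walk y x).IsPath := by
          simp [hadj.ne']
        have h3 := egirth_le_of_isPath h1 h2 (by
          intro h4
          apply hpen
          have h5 : s(x.1, y) ∈ (P x).edges := by
            apply Walk.edges_dropUntil_subset_edges _ hys
            rw [h4]; simp [Sym2.eq_swap]
          exact (hP x).eq_penultimate_of_mem_edges h5)
        have h4 : ((P x).dropUntil y hys).length ≤ j :=
          ((P x).length_dropUntil_le_length hys).trans (hPlen x).le
        have h5 := hR.trans_le h3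
        rw [Nat.cast_lt] at h5
        simp only [Walk.length_cons, Walk.length_nil] at h5
        omega
      have hpath : ∀ x, ∀ y (hy : y ∈ C x), ((P x).concat (mem_filter.1 hy).2.1).IsPath :=
        fun x y hy => (hP x).concat (hsupp x y hy) _
      calc D ^ (j + 1) = #(S j) * 0 + D ^ j * D := by rw [pow_succ]; ring
        _ ≤ #(S j) * D := by
          rw [mul_zero, zero_add]; exact Nat.mul_le_mul_right _ (ih (by omega))
        _ = ∑ x : S j, D := by simp
        _ ≤ ∑ x : S j, #(C x) := sum_le_sum fun x _ => hC x
        _ = #(univ.sigma C) := (card_sigma _ _).symm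
        _ ≤ #(S (j + 1)) := by
          refine card_le_card_of_injOn (fun z => z.2) ?_ ?_
          · rintro ⟨x, y⟩ hz
            have hy : y ∈ C x := by simpa using hz
            refine mem_coe.2 (mem_filter.2 ⟨(mem_filter.1 hy).1, _, hpath x y hy, ?_⟩)
            rw [Walk.length_concat, hPlen]
          · rintro ⟨x, y⟩ hz ⟨x', y'⟩ hz' h
            have hy : y ∈ C x := by simpa using hz
            have hy' : y' ∈ C x' := by simpa using hz'
            simp only at h
            subst h
            -- Reaching `y` from two different `x` would give two distinct paths of length `j + 1`,
            -- hence a cycle of length at most `2 * R`.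
            by_cases hxx : x = x'
            · rw [hxx]
            exfalso
            have h1 := egirth_le_of_isPath (hpath x y hy) (hpath x' y hy') (by
              intro h2
              have h3 := congrArg Walk.penultimate h2
              simp only [Walk.penultimate_concat] at h3
              exact hxx (Subtype.ext h3))
            have h5 := hR.trans_le h1
            rw [Nat.cast_lt, Walk.length_concat, Walk.length_concat, hPlen, hPlen] at h5
            omega
  exact (key R le_rfl).trans (card_le_univ _)

/-- The edges of `G`, as ordered pairs. -/
noncomputable def edgePairs {n : ℕ} (G : SimpleGraph (Fin n)) : Finset (Fin n × Fin n) :=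
  open Classical in {p | p.1 < p.2 ∧ G.Adj p.1 p.2}

theorem mem_edgePairs {n : ℕ} {G : SimpleGraph (Fin n)} {p : Fin n × Fin n} :
    p ∈ edgePairs G ↔ p.1 < p.2 ∧ G.Adj p.1 p.2 := by
  simp [edgePairs]

/-- A weak Moore bound for irregular graphs. -/
theorem egirth_le_of_card_lt_pow {n : ℕ} {G : SimpleGraph (Fin n)} {D R : ℕ} (hn : 0 < n)
    (hD : 0 < D) (hm : D * n ≤ #(edgePairs G)) (hR : n < D ^ R) : G.egirth ≤ (2 * R : ℕ) := by
  classical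
  by_contra hcon
  rw [not_le] at hcon
  let e : Finset (Fin n) → ℕ := fun W => #{p ∈ edgePairs G | p.1 ∈ W ∧ p.2 ∈ W}
  let 𝒲 : Finset (Finset (Fin n)) := {W | W.Nonempty ∧ D * #W ≤ e W}
  have h𝒲 : 𝒲.Nonempty := by
    refine ⟨univ, mem_filter.2 ⟨mem_univ _, ⟨⟨0, hn⟩, mem_univ _⟩, ?_⟩⟩
    simpa [e] using hm
  -- `W` is a smallest nonempty set spanning at least `D` edges per vertex. Deleting a vertex with
  -- at most `D` neighbours in `W` would preserve this ratio, so all inner degrees are at least `D +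
  -- 1`.
  obtain ⟨W, hW, hmin⟩ := exists_min_image 𝒲 card h𝒲
  obtain ⟨-, ⟨v, hv⟩, hWe⟩ := mem_filter.1 hW
  have hdeg : ∀ x ∈ W, D + 1 ≤ #{y ∈ W | G.Adj x y} := by
    intro x hx
    have h1 : e W ≤ e (W.erase x) + #{y ∈ W | G.Adj x y} := by
      have hsub : {p ∈ edgePairs G | p.1 ∈ W ∧ p.2 ∈ W} ⊆
          {p ∈ edgePairs G | p.1 ∈ W.erase x ∧ p.2 ∈ W.erase x} ∪
          ({y ∈ W | G.Adj x y}).image fun y => if x < y then (x, y) else (y, x) := by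
        rintro ⟨a, b⟩ hp
        simp only [mem_filter, mem_edgePairs] at hp
        obtain ⟨⟨hlt, hadj⟩, ha, hb⟩ := hp
        simp only [mem_union, mem_filter, mem_edgePairs, mem_erase, mem_image]
        by_cases hax : a = x
        · subst hax
          exact Or.inr ⟨b, ⟨hb, hadj⟩, if_pos hlt⟩
        by_cases hbx : b = x
        · subst hbx
          exact Or.inr ⟨a, ⟨ha, hadj.symm⟩, if_neg hlt.asymm⟩
        · exact Or.inl ⟨⟨hlt, hadj⟩, ⟨hax, ha⟩, hbx, hb⟩
      exact (card_le_card hsub).trans ((card_union_le _ _).trans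
        (Nat.add_le_add_left card_image_le _))
    have hcard : #(W.erase x) + 1 = #W := card_erase_add_one hx
    by_cases hne : (W.erase x).Nonempty
    · have h2 : ¬ D * #(W.erase x) ≤ e (W.erase x) := by
        intro h3
        have := hmin (W.erase x) (mem_filter.2 ⟨mem_univ _, hne, h3⟩)
        omega
      rw [← hcard, mul_add, mul_one] at hWe
      omega
    -- A single vertex spans no edges, contradicting the ratio because `D` is positive.
    · rw [not_nonempty_iff_eq_empty] at hne
      have h2 : e (W.erase x) = 0 := by rw [hne]; simp [e]
      have h3 : #{y ∈ W | G.Adj x y} = 0 := by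
        rw [card_eq_zero, filter_eq_empty_iff]
        intro y hy hadj
        have : y ∈ W.erase x := mem_erase.2 ⟨hadj.ne', hy⟩
        rw [hne] at this
        simp at this
      have h4 : 0 < #W := card_pos.2 ⟨x, hx⟩
      have : 0 < D * #W := Nat.mul_pos hD h4
      omega
  have := pow_le_card_of_lt_egirth hv hdeg hcon
  rw [Fintype.card_fin] at this
  omega

variable {ε : Type*}

/-- The set `F` of (labels of) edges is the edge set of a path from `v` to `u`. -/
def IsPathSet (e : ε → Sym2 V) (v u : V) (F : Finset ε) : Prop :=
  ∃ p : (⊤ : SimpleGraph V).Walk v u, p.IsPath ∧ ∀ x, x ∈ p.edges ↔ ∃ r ∈ F, e r = x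

variable {e : ε → Sym2 V} {E : Finset ε}

/-- `IsPathSet` speaks of the complete graph, so a node can test it without knowing `G`. Labels in
`E` place the path inside `G`, and injectivity makes their number its length. -/
theorem IsPathSet.exists_path (hE : ∀ r ∈ E, e r ∈ G.edgeSet) (hinj : Set.InjOn e E) {v u : V}
    {F : Finset ε} (hF : IsPathSet e v u F) (hFE : F ⊆ E) :
    ∃ p : G.Walk v u, p.IsPath ∧ p.length = #F ∧ ∀ x, x ∈ p.edges ↔ ∃ r ∈ F, e r = x := by
  classical
  obtain ⟨p, hp, hpF⟩ := hF
  have hpG : ∀ x ∈ p.edges, x ∈ G.edgeSet := by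
    intro x hx
    obtain ⟨r, hr, rfl⟩ := (hpF x).1 hx
    exact hE r (hFE hr)
  refine ⟨p.transfer G hpG, hp.transfer hpG, ?_, by simpa using hpF⟩
  rw [Walk.length_transfer, ← Walk.length_edges,
    ← List.toFinset_card_of_nodup hp.isTrail.edges_nodup,
    ← card_image_of_injOn (hinj.mono (coe_subset.2 hFE))]
  congr 1
  ext x
  simp [hpF]

theorem exists_isPathSet (hE : ∀ x ∈ G.edgeSet, ∃ r ∈ E, e r = x) (hinj : Set.InjOn e E) {v u : V}
    {p : G.Walk v u} (hp : p.IsPath) : ∃ F ⊆ E, IsPathSet e v u F ∧ #F = p.length ∧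
      ∀ x, x ∈ p.edges ↔ ∃ r ∈ F, e r = x := by
  classical
  have hpE : ∀ x, x ∈ p.edges ↔ ∃ r ∈ {r ∈ E | e r ∈ p.edges}, e r = x := by
    intro x
    simp only [mem_filter]
    constructor
    · intro hx
      obtain ⟨r, hr, rfl⟩ := hE x (p.edges_subset_edgeSet hx)
      exact ⟨r, ⟨hr, hx⟩, rfl⟩
    · rintro ⟨r, ⟨_, hr⟩, rfl⟩; exact hr
  have hpT : ∀ x ∈ p.edges, x ∈ (⊤ : SimpleGraph V).edgeSet := fun x hx =>
    edgeSet_mono le_top (p.edges_subset_edgeSet hx)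
  refine ⟨{r ∈ E | e r ∈ p.edges}, filter_subset _ _,
    ⟨p.transfer _ hpT, hp.transfer hpT, by simpa using hpE⟩, ?_, hpE⟩
  rw [← Walk.length_edges, ← List.toFinset_card_of_nodup hp.isTrail.edges_nodup,
    ← card_image_of_injOn (hinj.mono (coe_subset.2 (filter_subset _ _)))]
  congr 1
  ext x
  rw [List.mem_toFinset, hpE, mem_image]

/-- Cycles of length at most `2 * r` are detected by pairs of edge sets of paths of length at
most `r` with the same ends. -/
theorem egirth_le_two_mul_iff (hE : ∀ x, x ∈ G.edgeSet ↔ ∃ r ∈ E, e r = x)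
    (hinj : Set.InjOn e E) (r : ℕ) : G.egirth ≤ (2 * r : ℕ) ↔
      ∃ v u, ∃ F ⊆ E, ∃ F' ⊆ E, F ≠ F' ∧ IsPathSet e v u F ∧ IsPathSet e v u F' ∧
        #F ≤ r ∧ #F' ≤ r := by
  constructor
  · intro h
    obtain ⟨v, u, p, q, hp, hq, hpr, hqr, x, hxp, hxq⟩ := exists_isPath_of_egirth_le h
    obtain ⟨F, hFE, hF, hFp, hFx⟩ := exists_isPathSet (fun x => (hE x).1) hinj hp
    obtain ⟨F', hFE', hF', hFp', hFx'⟩ := exists_isPathSet (fun x => (hE x).1) hinj hq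
    refine ⟨v, u, F, hFE, F', hFE', ?_, hF, hF', hFp.trans_le hpr, hFp'.trans_le hqr⟩
    rintro rfl
    exact hxq ((hFx' x).2 ((hFx x).1 hxp))
  · rintro ⟨v, u, F, hFE, F', hFE', hne, hF, hF', hr, hr'⟩
    have hE' : ∀ r ∈ E, e r ∈ G.edgeSet := fun r hr => (hE _).2 ⟨r, hr, rfl⟩
    obtain ⟨p, hp, hpl, hpx⟩ := hF.exists_path hE' hinj hFE
    obtain ⟨q, hq, hql, hqx⟩ := hF'.exists_path hE' hinj hFE'
    refine (egirth_le_of_isPath hp hq ?_).trans (Nat.cast_le.2 (by omega))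
    rintro rfl
    apply hne
    ext a
    constructor
    · intro ha
      obtain ⟨b, hb, hab⟩ := (hqx _).1 ((hpx (e a)).2 ⟨a, ha, rfl⟩)
      rwa [← hinj (hFE' hb) (hFE ha) hab]
    · intro ha
      obtain ⟨b, hb, hab⟩ := (hpx _).1 ((hqx (e a)).2 ⟨a, ha, rfl⟩)
      rwa [← hinj (hFE hb) (hFE' ha) hab]

end Girth

/-! ### Covering all small sets of blocks. -/

section Cover

/-- `k ^ k / k!` is one term of the series of `e ^ k`, and `e < 3`. -/
theorem pow_self_le (k : ℕ) : k ^ k ≤ 3 ^ k * k.factorial := by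
  have h1 := Real.pow_div_factorial_le_exp (x := k) (by positivity) k
  have h2 : Real.exp k ≤ 3 ^ k := by
    rw [← Real.exp_one_pow]
    exact pow_le_pow_left₀ (Real.exp_pos 1).le Real.exp_one_lt_three.le k
  rw [div_le_iff₀ (by positivity)] at h1
  have h3 : ((k : ℝ)) ^ k ≤ 3 ^ k * (k.factorial : ℝ) :=
    h1.trans (mul_le_mul_of_nonneg_right h2 (by positivity))
  exact_mod_cast h3

theorem choose_mul_le (q k : ℕ) : (q * k).choose k ≤ (3 * q) ^ k := by
  have h1 : (q * k).choose k * k.factorial ≤ (3 * q) ^ k * k.factorial := by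
    calc _ = (q * k).descFactorial k := by
          rw [Nat.descFactorial_eq_factorial_mul_choose, mul_comm]
      _ ≤ (q * k) ^ k := Nat.descFactorial_le_pow _ _
      _ = q ^ k * k ^ k := mul_pow _ _ _
      _ ≤ q ^ k * (3 ^ k * k.factorial) := Nat.mul_le_mul_left _ (pow_self_le k)
      _ = _ := by rw [mul_pow]; ring
  exact Nat.le_of_mul_le_mul_right h1 (Nat.factorial_pos k)

/-- An assignment of sets of at most `k` out of `q * k` blocks to `n` nodes such that every `k`
blocks are assigned together to some node, and no block is assigned to more than `n / q` nodes. -/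
theorem exists_cover {n q k : ℕ} (hq : 0 < q) (hk : 0 < k) (hn : (3 * q) ^ k ≤ n) :
    ∃ S : Fin n → Finset ℕ, (∀ w, #(S w) ≤ k) ∧
      (∀ T ⊆ range (q * k), #T ≤ k → ∃ w, T ⊆ S w) ∧ ∀ b, q * #{w | b ∈ S w} ≤ n := by
  classical
  let 𝒯 := powersetCard k (range (q * k))
  have h𝒯 : #𝒯 = (q * k).choose k := by simp [𝒯]
  have h𝒯n : #𝒯 ≤ n := h𝒯.trans_le ((choose_mul_le q k).trans hn)
  let S : Fin n → Finset ℕ := fun w => if h : w.1 < #𝒯 then (𝒯.equivFin.symm ⟨w, h⟩).1 else ∅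
  have hS : ∀ w, ∀ h : w.1 < #𝒯, S w = (𝒯.equivFin.symm ⟨w, h⟩).1 := fun w h => dif_pos h
  have hS𝒯 : ∀ w, w.1 < #𝒯 → S w ∈ 𝒯 := by
    intro w h
    rw [hS w h]
    exact (𝒯.equivFin.symm ⟨w, h⟩).2
  have hS' : ∀ w, ¬ w.1 < #𝒯 → S w = ∅ := fun w h => dif_neg h
  refine ⟨S, ?_, ?_, ?_⟩
  · intro w
    by_cases h : w.1 < #𝒯
    · exact (mem_powersetCard.1 (hS𝒯 w h)).2.le
    · rw [hS' w h]; simp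
  · intro T hT hTk
    -- Only sets of exactly `k` blocks are enumerated, so a smaller `T` is first enlarged.
    obtain ⟨T', hTT', hT', hcard⟩ := exists_subsuperset_card_eq hT hTk
      (by rw [card_range]; exact Nat.le_mul_of_pos_left k hq)
    have hmem : T' ∈ 𝒯 := mem_powersetCard.2 ⟨hT', hcard⟩
    let i := 𝒯.equivFin ⟨T', hmem⟩
    refine ⟨⟨i, i.2.trans_le h𝒯n⟩, ?_⟩
    rw [hS _ i.2]
    simpa [i] using hTT'
  · intro b
    obtain ⟨k, rfl⟩ : ∃ k', k = k' + 1 := ⟨k - 1, by omega⟩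
    obtain ⟨p, hp⟩ : ∃ p, q * (k + 1) = p + 1 :=
      ⟨q * (k + 1) - 1, by have := Nat.mul_pos hq hk; omega⟩
    have h1 : #{w : Fin n | b ∈ S w} ≤ p.choose k := by
      by_cases hb : b ∈ range (q * (k + 1))
      · calc #{w : Fin n | b ∈ S w} ≤ #(powersetCard k ((range (q * (k + 1))).erase b)) := by
              refine card_le_card_of_injOn (fun w => (S w).erase b) ?_ ?_
              · intro w hw
                have hw : b ∈ S w := by simpa using hw
                have hlt : w.1 < #𝒯 := by
                  by_contra h
                  rw [hS' w h] at hw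
                  simp at hw
                have h2 := mem_powersetCard.1 (hS𝒯 w hlt)
                refine mem_coe.2 (mem_powersetCard.2 ⟨erase_subset_erase _ h2.1, ?_⟩)
                rw [card_erase_of_mem hw, h2.2, Nat.add_sub_cancel]
              · intro w hw w' hw' h
                have hw : b ∈ S w := by simpa using hw
                have hw' : b ∈ S w' := by simpa using hw'
                have h3 : S w = S w' := by
                  rw [← insert_erase hw, ← insert_erase hw']
                  simp only at h
                  rw [h]
                have hlt : w.1 < #𝒯 := by
                  by_contra h
                  rw [hS' w h] at hw
                  simp at hw
                have hlt' : w'.1 < #𝒯 := by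
                  by_contra h
                  rw [hS' w' h] at hw'
                  simp at hw'
                rw [hS w hlt, hS w' hlt'] at h3
                have h4 := 𝒯.equivFin.symm.injective (Subtype.ext h3)
                exact Fin.ext (by simpa using h4)
          _ = p.choose k := by
              rw [card_powersetCard, card_erase_of_mem hb, card_range, hp, Nat.add_sub_cancel]
      · refine (le_of_eq ?_).trans (Nat.zero_le _)
        · rw [card_eq_zero, filter_eq_empty_iff]
          intro w _ hw
          by_cases h : w.1 < #𝒯
          · exact hb ((mem_powersetCard.1 (hS𝒯 w h)).1 hw)
          · rw [hS' w h] at hw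
            simp at hw
    -- A fixed block lies in the fraction `1 / q` of all `k`-sets, since each set holds `k` of the
    -- `q * k` blocks; here `k` has been replaced by `k + 1`.
    have h2 : q * p.choose k = (q * (k + 1)).choose (k + 1) := by
      have := Nat.add_one_mul_choose_eq p k
      rw [← hp] at this
      apply Nat.eq_of_mul_eq_mul_right (Nat.succ_pos k)
      rw [← this, Nat.succ_eq_add_one]; ring
    calc q * #{w | b ∈ S w} ≤ q * p.choose k := Nat.mul_le_mul_left _ h1
      _ = #𝒯 := by rw [h2, h𝒯]
      _ ≤ n := h𝒯n

end Cover

end CongestedClique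

/-! ### Numbering the edges. -/

namespace CongestedClique

open Finset SimpleGraph

variable {n B t : ℕ} {X Y Z : Type}

section EdgeRecords

open Classical in
/-- The neighbours of `v` with a larger identifier. -/
noncomputable def upperNeighbors (G : SimpleGraph (Fin n)) (v : Fin n) : Finset (Fin n) :=
  {u | v < u ∧ G.Adj v u}

theorem mem_upperNeighbors {G : SimpleGraph (Fin n)} {v u : Fin n} :
    u ∈ upperNeighbors G v ↔ v < u ∧ G.Adj v u := by
  simp [upperNeighbors]

noncomputable def upperDegree (G : SimpleGraph (Fin n)) (v : Fin n) : ℕ := #(upperNeighbors G v)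

/-- A numbering of the edges of `G`. -/
noncomputable def edgeIndex (G : SimpleGraph (Fin n)) (p : Fin n × Fin n) : ℕ :=
  ∑ x ∈ Iio p.1, upperDegree G x + rank (upperNeighbors G p.1) p.2

noncomputable def edgeCount (G : SimpleGraph (Fin n)) : ℕ := ∑ v, upperDegree G v

variable {G : SimpleGraph (Fin n)}

theorem edgeIndex_lt_sum_Iic {p : Fin n × Fin n} (hp : p ∈ edgePairs G) :
    edgeIndex G p < ∑ x ∈ Iic p.1, upperDegree G x := by
  rw [← Finset.Iio_insert, sum_insert (by simp), edgeIndex, add_comm]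
  exact Nat.add_lt_add_right (rank_lt (mem_upperNeighbors.2 (mem_edgePairs.1 hp))) _

theorem edgeIndex_lt_edgeCount {p : Fin n × Fin n} (hp : p ∈ edgePairs G) :
    edgeIndex G p < edgeCount G :=
  (edgeIndex_lt_sum_Iic hp).trans_le (sum_le_sum_of_subset (subset_univ _))

theorem edgeIndex_lt_of_lt {p p' : Fin n × Fin n} (hp : p ∈ edgePairs G) (h : p.1 < p'.1) :
    edgeIndex G p < edgeIndex G p' := by
  refine (edgeIndex_lt_sum_Iic hp).trans_le (le_trans (sum_le_sum_of_subset ?_) (Nat.le_add_right _ _))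
  intro x hx
  exact mem_Iio.2 ((mem_Iic.1 hx).trans_lt h)

/-- Each lower endpoint owns an interval of numbers, placed by the degrees before it. Thus a node
can number its own edges once all degrees are known. -/
theorem edgeIndex_injOn : Set.InjOn (edgeIndex G) (edgePairs G) := by
  intro p hp p' hp' h
  rcases lt_trichotomy p.1 p'.1 with h1 | h1 | h1
  · exact absurd h (edgeIndex_lt_of_lt hp h1).ne
  · refine Prod.ext h1 ?_
    simp only [edgeIndex, h1, Nat.add_left_cancel_iff] at h
    refine rank_injOn _ ?_ (mem_upperNeighbors.2 (mem_edgePairs.1 hp')) h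
    rw [← h1]
    exact mem_upperNeighbors.2 (mem_edgePairs.1 hp)
  · exact absurd h (edgeIndex_lt_of_lt hp' h1).ne'

theorem edgeCount_le_card_edgePairs : edgeCount G ≤ #(edgePairs G) := by
  rw [card_eq_sum_card_fiberwise (f := Prod.fst) (t := univ) (by simp)]
  refine sum_le_sum fun v _ => card_le_card_of_injOn (fun u => (v, u)) ?_ ?_
  · intro u hu
    simpa [mem_edgePairs] using mem_upperNeighbors.1 hu
  · intro u _ u' _ h
    simpa using h

theorem upperDegree_le (v : Fin n) : upperDegree G v ≤ n :=
  (card_le_univ _).trans (by simp)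

theorem edgeCount_le : edgeCount G ≤ n * n :=
  (sum_le_sum fun v _ => upperDegree_le v).trans (by simp)

/-- Edges together with numbers. -/
abbrev EdgeRecord (n : ℕ) : Type := (Fin n × Fin n) × Fin (n * n)

/-- The edges of `G` together with their numbers. -/
noncomputable def edgeRecords (G : SimpleGraph (Fin n)) : Finset (EdgeRecord n) :=
  {r | r.1 ∈ edgePairs G ∧ (r.2 : ℕ) = edgeIndex G r.1}

theorem mem_edgeRecords {r : EdgeRecord n} :
    r ∈ edgeRecords G ↔ r.1 ∈ edgePairs G ∧ (r.2 : ℕ) = edgeIndex G r.1 := by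
  simp [edgeRecords]

def EdgeRecord.edge (r : EdgeRecord n) : Sym2 (Fin n) := s(r.1.1, r.1.2)

theorem edgeRecords_ext {r r' : EdgeRecord n} (hr : r ∈ edgeRecords G) (hr' : r' ∈ edgeRecords G)
    (h : r.1 = r'.1) : r = r' := by
  rw [mem_edgeRecords] at hr hr'
  exact Prod.ext h (Fin.ext (by rw [hr.2, hr'.2, h]))

theorem edgeRecords_index_injOn :
    Set.InjOn (fun r : EdgeRecord n => (r.2 : ℕ)) (edgeRecords G) := by
  intro r hr r' hr' h
  refine edgeRecords_ext hr hr' ?_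
  have hr := mem_edgeRecords.1 hr
  have hr' := mem_edgeRecords.1 hr'
  exact edgeIndex_injOn hr.1 hr'.1 (by rw [← hr.2, ← hr'.2]; exact h)

theorem edgeRecords_index_lt {r : EdgeRecord n} (hr : r ∈ edgeRecords G) : r.2 < edgeCount G := by
  rw [mem_edgeRecords] at hr
  rw [hr.2]
  exact edgeIndex_lt_edgeCount hr.1

theorem edgeRecords_edge_injOn : Set.InjOn (EdgeRecord.edge (n := n)) (edgeRecords G) := by
  intro r hr r' hr' h
  refine edgeRecords_ext hr hr' ?_
  have h1 := (mem_edgePairs.1 (mem_edgeRecords.1 hr).1).1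
  have h2 := (mem_edgePairs.1 (mem_edgeRecords.1 hr').1).1
  simp only [EdgeRecord.edge, Sym2.eq_iff] at h
  rcases h with h | h
  · exact Prod.ext h.1 h.2
  · rw [h.1, h.2] at h1
    exact absurd h2 h1.asymm

theorem mem_edgeSet_iff_edgeRecords {x : Sym2 (Fin n)} :
    x ∈ G.edgeSet ↔ ∃ r ∈ edgeRecords G, EdgeRecord.edge r = x := by
  have hrec : ∀ p ∈ edgePairs G, ∃ r ∈ edgeRecords G, r.1 = p := fun p hp =>
    ⟨(p, ⟨edgeIndex G p, (edgeIndex_lt_edgeCount hp).trans_le edgeCount_le⟩),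
      mem_edgeRecords.2 ⟨hp, rfl⟩, rfl⟩
  constructor
  · induction x with | _ a b
    intro h
    rw [mem_edgeSet] at h
    rcases lt_or_gt_of_ne h.ne with hab | hab
    · obtain ⟨r, hr, hp⟩ := hrec (a, b) (mem_edgePairs.2 ⟨hab, h⟩)
      exact ⟨r, hr, by rw [EdgeRecord.edge, hp]⟩
    · obtain ⟨r, hr, hp⟩ := hrec (b, a) (mem_edgePairs.2 ⟨hab, h.symm⟩)
      exact ⟨r, hr, by rw [EdgeRecord.edge, hp, Sym2.eq_swap]⟩
  · rintro ⟨r, hr, rfl⟩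
    exact (mem_edgePairs.1 (mem_edgeRecords.1 hr).1).2

theorem card_edgeRecords_mod_le {N K : ℕ} (hN : 0 < N) (h : edgeCount G ≤ K * N) (y : ℕ) :
    #{r ∈ edgeRecords G | (r.2 : ℕ) % N = y} ≤ K :=
  card_filter_mod_le hN (fun _ hr => (edgeRecords_index_lt hr).trans_le h)
    edgeRecords_index_injOn y

theorem edgeCount_le_mul (hn : 0 < n) : edgeCount G ≤ (edgeCount G / n + 1) * n := by
  rw [mul_comm]
  exact (Nat.lt_mul_div_succ _ hn).le

theorem edgeRecords_injective {G' : SimpleGraph (Fin n)} (h : edgeRecords G = edgeRecords G') :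
    G = G' := by
  rw [← SimpleGraph.edgeSet_inj]
  ext x
  rw [mem_edgeSet_iff_edgeRecords, mem_edgeSet_iff_edgeRecords, h]

end EdgeRecords

/-! ### Distributing blocks of edges to the nodes. -/

section Distribution

/-- The block size parameter for a graph with `m` edges. -/
def blockRatio (n m : ℕ) : ℕ := m / n / 3

/-- The maximum length of the considered paths in a graph with `m` edges. -/
def pathBound (n m : ℕ) : ℕ := Nat.log (m / n) n

open Classical in
/-- The sets of blocks of edges assigned to the nodes. -/
noncomputable def blockSets (n m : ℕ) : Fin n → Finset ℕ :=
  if h : 0 < blockRatio n m ∧ 0 < pathBound n m ∧ (3 * blockRatio n m) ^ pathBound n m ≤ n then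
    (exists_cover h.1 h.2.1 h.2.2).choose
  else fun _ => ∅

/-- The node `w` is to learn the edge record `r`. -/
def IsAssigned (m : ℕ) (w : Fin n) (r : EdgeRecord n) : Prop :=
  (r.2 : ℕ) % (blockRatio n m * pathBound n m) ∈ blockSets n m w

/-- The edges of `G` if their number is large, and no edges otherwise. -/
noncomputable def denseEdges (G : SimpleGraph (Fin n)) : Finset (EdgeRecord n) :=
  if edgeCount G / n < 6 then ∅ else edgeRecords G

/-- The edges of `G` if their number is small, and no edges otherwise. -/
noncomputable def sparseEdges (G : SimpleGraph (Fin n)) : Finset (EdgeRecord n) :=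
  if edgeCount G / n < 6 then edgeRecords G else ∅

open Classical in
/-- The edges that the node `w` is to learn. -/
noncomputable def assignedEdges (G : SimpleGraph (Fin n)) (w : Fin n) : Finset (EdgeRecord n) :=
  {r ∈ denseEdges G | IsAssigned (edgeCount G) w r}

variable {G : SimpleGraph (Fin n)}

theorem pathBound_le {m : ℕ} : pathBound n m ≤ Nat.log 2 n := by
  rcases Nat.lt_or_ge 1 (m / n) with hD | hD
  · exact Nat.log_anti_left (by norm_num) hD
  · rw [pathBound, Nat.log_of_left_le_one hD]
    exact Nat.zero_le _

theorem pathBound_pos {m : ℕ} (hm : m ≤ n * n) (hD : 6 ≤ m / n) :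
    0 < pathBound n m :=
  Nat.log_pos (by omega) (Nat.div_le_of_le_mul hm)

/-- For `D = m / n ≥ 6` the ratio `q = ⌊D / 3⌋` is positive, and `(3q)^k ≤ D^k ≤ n` for `k = ⌊log_D
n⌋`, so the cover exists. -/
theorem blockSets_spec {m : ℕ} (hn : 0 < n) (hm : m ≤ n * n) (hD : 6 ≤ m / n) :
    (∀ w, #(blockSets n m w) ≤ pathBound n m) ∧
      (∀ T ⊆ range (blockRatio n m * pathBound n m), #T ≤ pathBound n m →
        ∃ w, T ⊆ blockSets n m w) ∧
      ∀ b, blockRatio n m * #{w | b ∈ blockSets n m w} ≤ n := by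
  have h : 0 < blockRatio n m ∧ 0 < pathBound n m ∧
      (3 * blockRatio n m) ^ pathBound n m ≤ n := by
    refine ⟨by unfold blockRatio; omega, pathBound_pos hm hD, ?_⟩
    calc (3 * blockRatio n m) ^ pathBound n m ≤ (m / n) ^ pathBound n m :=
          Nat.pow_le_pow_left (by unfold blockRatio; omega) _
      _ ≤ n := Nat.pow_log_le_self _ (by omega)
  rw [blockSets, dif_pos h]
  exact (exists_cover h.1 h.2.1 h.2.2).choose_spec

/-- The `k` blocks hold about `m / (qk)` edges each, together `m / q ≤ 5n` because `D + 1 ≤ 5q`;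
rounding adds at most `k ≤ n`. -/
theorem card_assignedEdges_le (hn : 2 ≤ n) (w : Fin n) : #(assignedEdges G w) ≤ 6 * n := by
  classical
  by_cases hD : edgeCount G / n < 6
  · simp [assignedEdges, denseEdges, hD]
  rw [not_lt] at hD
  obtain ⟨h1, -, -⟩ := blockSets_spec (by omega) edgeCount_le hD
  have hk := pathBound_pos (n := n) edgeCount_le hD
  have hkn : pathBound n (edgeCount G) ≤ n := pathBound_le.trans (Nat.log_le_self _ _)
  have hq : 0 < blockRatio n (edgeCount G) := by unfold blockRatio; omega
  set q := blockRatio n (edgeCount G) with hqd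
  set k := pathBound n (edgeCount G)
  have hqk : 0 < q * k := Nat.mul_pos hq hk
  have hmq : edgeCount G ≤ 5 * q * n := by
    refine (edgeCount_le_mul (by omega)).trans (Nat.mul_le_mul_right _ ?_)
    rw [hqd, blockRatio]
    omega
  calc #(assignedEdges G w)
      ≤ #((blockSets n (edgeCount G) w).biUnion fun b => {r ∈ edgeRecords G | (r.2 : ℕ) % (q * k) = b}) := by
        refine card_le_card fun r hr => ?_
        simp only [assignedEdges, denseEdges, not_lt.2 hD, if_false, mem_filter, IsAssigned] at hr
        simp only [mem_biUnion, mem_filter]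
        exact ⟨_, hr.2, hr.1, rfl⟩
    _ ≤ ∑ b ∈ blockSets n (edgeCount G) w, (edgeCount G / (q * k) + 1) := by
        refine card_biUnion_le.trans (sum_le_sum fun b _ => card_edgeRecords_mod_le hqk ?_ b)
        rw [mul_comm]
        exact (Nat.lt_mul_div_succ _ hqk).le
    _ ≤ k * (edgeCount G / (q * k) + 1) := by
        rw [sum_const, smul_eq_mul]
        exact Nat.mul_le_mul_right _ (h1 w)
    _ = k * (edgeCount G / q / k) + k := by rw [Nat.div_div_eq_div_mul]; ring
    _ ≤ edgeCount G / q + n := Nat.add_le_add (Nat.mul_div_le _ _) hkn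
    _ ≤ 5 * n + n := by
        refine Nat.add_le_add_right (Nat.div_le_of_le_mul ?_) _
        linarith
    _ = 6 * n := by ring

/-- A residue class modulo `n` holds at most `D + 1 ≤ 6q` edges, each wanted by at most `n / q`
nodes. -/
theorem card_assigned_source_le (hn : 2 ≤ n) (y : ℕ) :
    #{x : EdgeRecord n × Fin n | x.1 ∈ assignedEdges G x.2 ∧ (x.1.2 : ℕ) % n = y} ≤ 6 * n := by
  classical
  by_cases hD : edgeCount G / n < 6
  · simp [assignedEdges, denseEdges, hD]
  rw [not_lt] at hD
  obtain ⟨-, -, h1⟩ := blockSets_spec (by omega) edgeCount_le hD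
  have hq : 0 < blockRatio n (edgeCount G) := by unfold blockRatio; omega
  set q := blockRatio n (edgeCount G) with hqd
  set k := pathBound n (edgeCount G)
  calc _ ≤ #({r ∈ edgeRecords G | (r.2 : ℕ) % n = y}.sigma
          fun r => ({w | (r.2 : ℕ) % (q * k) ∈ blockSets n (edgeCount G) w} : Finset (Fin n))) := by
        refine card_le_card_of_injOn (fun x => ⟨x.1, x.2⟩) ?_ ?_
        · intro x hx
          simp only [assignedEdges, denseEdges, not_lt.2 hD, if_false, mem_coe, mem_filter,
            IsAssigned, mem_univ, true_and] at hx
          simp only [mem_coe, mem_sigma, mem_filter, mem_univ, true_and]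
          exact ⟨⟨hx.1.1, hx.2⟩, hx.1.2⟩
        · intro x _ x' _ h
          simp only [Sigma.mk.injEq, heq_eq_eq] at h
          exact Prod.ext h.1 h.2
    _ ≤ ∑ r ∈ {r ∈ edgeRecords G | (r.2 : ℕ) % n = y}, n / q := by
        rw [card_sigma]
        refine sum_le_sum fun r _ => (Nat.le_div_iff_mul_le hq).2 ?_
        rw [mul_comm]
        exact h1 _
    _ ≤ (edgeCount G / n + 1) * (n / q) := by
        rw [sum_const, smul_eq_mul]
        exact Nat.mul_le_mul_right _
          (card_edgeRecords_mod_le (by omega) (edgeCount_le_mul (by omega)) y)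
    _ ≤ (6 * q) * (n / q) := by
        refine Nat.mul_le_mul_right _ ?_
        rw [hqd, blockRatio]
        omega
    _ = 6 * (q * (n / q)) := by ring
    _ ≤ 6 * n := Nat.mul_le_mul_left _ (Nat.mul_div_le _ _)

theorem card_edgeRecord_le : Fintype.card (EdgeRecord n) ≤ n ^ 4 := by
  simp only [Fintype.card_prod, Fintype.card_fin]
  exact le_of_eq (by ring)

/-- After eleven rounds every node can know its assigned edges, and the whole graph
if there are only few edges. -/
theorem knows_assignedEdges (hn : 2 ≤ n) (hB : routingBandwidth 5 6 * Nat.log 2 n ≤ B) :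
    Knows B 11 fun (G : SimpleGraph (Fin n)) v =>
      (edgeCount G, sparseEdges G, assignedEdges G v) := by
  classical
  have hL : 1 ≤ Nat.log 2 n := Nat.log_pos (by norm_num) hn
  have hn0 : 0 < n := by omega
  have hbw : ∀ a' K', a' ≤ 5 → K' ≤ 632 → (2 * a' + 1) * K' * Nat.log 2 n ≤ B :=
    fun a' K' h1 h2 => le_routingBandwidth hB (by omega) (by omega)
  have hcount : ∀ G G' : SimpleGraph (Fin n), upperDegree G = upperDegree G' →
      edgeCount G = edgeCount G' := fun G G' h => by rw [edgeCount, h, edgeCount]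
  have k1 := (knows_neighborSet (n := n) B).broadcast (M := Fin (n + 1))
    (by
      have := succ_pow_le_two_pow hn (N := n) (a := 1) (K := 1) (by simp) (hbw 1 1 (by omega) (by omega))
      simpa using this)
    (m := fun G v => ⟨upperDegree G v, Nat.lt_succ_of_le (upperDegree_le v)⟩) (by
      intro G G' v h
      have h : ∀ u, G.Adj v u ↔ G'.Adj v u := fun u => Set.ext_iff.1 h u
      simp only [upperDegree, upperNeighbors, h])
  have k2 := k1.forward hn 4 1 card_edgeRecord_le (hbw 4 1 (by omega) (by omega)) edgeRecords
    (fun _ r => r.1.1) (fun _ r => ⟨r.2 % n, Nat.mod_lt _ hn0⟩) (by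
      intro G u y
      rw [card_le_one]
      intro r hr r' hr'
      simp only [mem_filter, Fin.ext_iff] at hr hr'
      refine edgeRecords_ext hr.1 hr'.1 (Prod.ext (Fin.ext (hr.2.1.trans hr'.2.1.symm)) ?_)
      have h1 := mem_edgeRecords.1 hr.1
      have h2 := mem_edgeRecords.1 hr'.1
      have h3 : r.1.1 = u := Fin.ext hr.2.1
      have h4 : r'.1.1 = u := Fin.ext hr'.2.1
      have h5 : r.1.2 ∈ upperNeighbors G u := by
        rw [← h3]; exact mem_upperNeighbors.2 (mem_edgePairs.1 h1.1)
      have h6 : r'.1.2 ∈ upperNeighbors G u := by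
        rw [← h4]; exact mem_upperNeighbors.2 (mem_edgePairs.1 h2.1)
      -- The edges of `u` have consecutive numbers, at most `n` of them, so equal residues force
      -- equal edges: one edge per link.
      have h7 : (edgeIndex G r.1) ≡ (edgeIndex G r'.1) [MOD n] := by
        rw [← h1.2, ← h2.2]; exact hr.2.2.trans hr'.2.2.symm
      simp only [edgeIndex, h3, h4] at h7
      have h8 := Nat.ModEq.add_left_cancel' _ h7
      exact rank_injOn _ h5 h6 (h8.eq_of_lt_of_lt
        ((rank_lt h5).trans_le (upperDegree_le u)) ((rank_lt h6).trans_le (upperDegree_le u)))) (by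
      intro G G' v h
      have h1 : ∀ u, G.Adj v u ↔ G'.Adj v u := fun u => Set.ext_iff.1 (congrArg Prod.fst h) u
      have h2 : upperDegree G = upperDegree G' := by
        have h3 := congrArg Prod.snd h
        funext u
        simpa using congrFun h3 u
      have h3 : upperNeighbors G v = upperNeighbors G' v := by
        simp only [upperNeighbors, h1]
      ext r
      simp only [mem_filter, mem_edgeRecords, mem_edgePairs, edgeIndex, h2]
      constructor
      · rintro ⟨⟨⟨h4, h5⟩, h6⟩, rfl⟩
        exact ⟨⟨⟨h4, (h1 _).1 h5⟩, by rw [h6, h3]⟩, rfl⟩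
      · rintro ⟨⟨⟨h4, h5⟩, h6⟩, rfl⟩
        exact ⟨⟨⟨h4, (h1 _).2 h5⟩, by rw [h6, h3]⟩, rfl⟩) (fun _ _ _ _ _ _ _ => rfl)
  have k2' : Knows B 2 fun (G : SimpleGraph (Fin n)) v => (upperDegree G,
      ({r ∈ edgeRecords G | (⟨r.2 % n, Nat.mod_lt _ hn0⟩ : Fin n) = v} : Finset (EdgeRecord n))) := by
    refine k2.mono ?_
    intro G G' v h
    have h2 := congrArg Prod.snd h
    refine Prod.ext ?_ h2
    have h3 := congrArg (fun x => x.1.2) h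
    funext u
    simpa using congrFun h3 u
  have : Nonempty {S : Finset (EdgeRecord n) // #S ≤ 6} := ⟨⟨∅, by simp⟩⟩
  have k3 := k2'.broadcast (M := {S : Finset (EdgeRecord n) // #S ≤ 6})
    ((card_finset_card_le_le _ 6).trans (succ_pow_le_two_pow hn card_edgeRecord_le
      (hbw 4 6 (by omega) (by omega))))
    -- In the sparse case `m < 6n`, so six edges per node suffice to announce everything; otherwise
    -- the empty set is sent.
    (m := fun G v => if h : edgeCount G / n < 6 then
      ⟨{r ∈ edgeRecords G | (⟨r.2 % n, Nat.mod_lt _ hn0⟩ : Fin n) = v}, by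
        have := card_edgeRecords_mod_le (G := G) (K := 6) hn0
          ((edgeCount_le_mul hn0).trans (Nat.mul_le_mul_right _ (by omega))) v
        simpa only [Fin.ext_iff] using this⟩ else ⟨∅, by simp⟩) (by
      intro G G' v h
      have h1 := hcount G G' (congrArg Prod.fst h)
      have h2 := congrArg Prod.snd h
      apply Subtype.ext
      simp only [h1]
      split_ifs
      · exact h2
      · rfl)
  have k3' : Knows B 3 fun (G : SimpleGraph (Fin n)) v => ((edgeCount G, sparseEdges G),
      ({r ∈ edgeRecords G | (⟨r.2 % n, Nat.mod_lt _ hn0⟩ : Fin n) = v} : Finset (EdgeRecord n))) := by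
    refine k3.mono ?_
    intro G G' v h
    have h1 := hcount G G' (congrArg (fun x => x.1.1) h)
    have h2 := congrArg (fun x => x.1.2) h
    refine Prod.ext (Prod.ext h1 ?_) h2
    have h3 := congrArg Prod.snd h
    simp only [sparseEdges, ← h1]
    split_ifs with hD
    · ext r
      have h4 := congrArg Subtype.val (congrFun h3 ⟨r.2 % n, Nat.mod_lt _ hn0⟩)
      have hD' : edgeCount G' / n < 6 := h1 ▸ hD
      simp only [hD, hD', dif_pos] at h4
      have h5 := Finset.ext_iff.1 h4 r
      simpa only [mem_filter, and_true] using h5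
    · rfl
  have hmod : ∀ (r : EdgeRecord n) (y : Fin n),
      (⟨r.2 % n, Nat.mod_lt _ hn0⟩ : Fin n) = y ↔ (r.2 : ℕ) % n = y :=
    fun r y => Fin.ext_iff
  have k4 := k3'.route hn 5 6 (by omega) (Msg := EdgeRecord n × Fin n) (by
      rw [Fintype.card_prod, Fintype.card_fin, pow_succ]
      exact Nat.mul_le_mul_right _ card_edgeRecord_le) hB
    (fun G => {x | x.1 ∈ assignedEdges G x.2}) (fun x => ⟨x.1.2 % n, Nat.mod_lt _ hn0⟩)
    (fun x => x.2) (by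
      intro G v
      have := card_assigned_source_le (G := G) hn v
      simpa only [filter_filter, hmod] using this) (by
      intro G v
      refine (card_le_card_of_injOn Prod.fst ?_ ?_).trans (card_assignedEdges_le (G := G) hn v)
      · intro x hx
        simp only [mem_coe, mem_filter, mem_univ, true_and] at hx
        rw [← hx.2]
        exact hx.1
      · intro x hx x' hx' h
        simp only [mem_coe, mem_filter, mem_univ, true_and] at hx hx'
        exact Prod.ext h (hx.2.trans hx'.2.symm)) (by
      intro G G' v h
      have h1 : edgeCount G = edgeCount G' := congrArg (fun x => x.1.1) h
      have h2 := congrArg Prod.snd h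
      ext x
      have h3 := Finset.ext_iff.1 h2 x.1
      simp only [mem_filter] at h3
      simp only [mem_filter, mem_univ, true_and, assignedEdges, denseEdges, h1]
      split_ifs
      · simp
      · constructor
        · rintro ⟨⟨h4, h5⟩, h6⟩
          exact ⟨⟨(h3.1 ⟨h4, h6⟩).1, h5⟩, h6⟩
        · rintro ⟨⟨h4, h5⟩, h6⟩
          exact ⟨⟨(h3.2 ⟨h4, h6⟩).1, h5⟩, h6⟩)
  refine k4.mono ?_
  intro G G' v h
  refine Prod.ext (congrArg (fun x => x.1.1.1) h) (Prod.ext (congrArg (fun x => x.1.1.2) h) ?_)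
  have h2 := congrArg Prod.snd h
  ext r
  have h3 := Finset.ext_iff.1 h2 (r, v)
  simpa using h3

/-- A node that learns all edges of the set `F`, if there is one. -/
noncomputable def ownerOf (hn : 0 < n) (m : ℕ) (F : Finset (EdgeRecord n)) : Fin n :=
  open Classical in if h : ∃ w, ∀ r ∈ F, IsAssigned m w r then h.choose else ⟨0, hn⟩

/-- At most `k` edges lie in at most `k` blocks, which the cover gives jointly to some node. The
owner depends only on `m` and `F`, so all nodes agree on it. -/
theorem isAssigned_ownerOf (hn : 0 < n) {F : Finset (EdgeRecord n)} (hF : F ⊆ denseEdges G)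
    (hk : #F ≤ pathBound n (edgeCount G)) {r : EdgeRecord n} (hr : r ∈ F) :
    IsAssigned (edgeCount G) (ownerOf hn (edgeCount G) F) r := by
  classical
  by_cases hD : edgeCount G / n < 6
  · have := hF hr
    simp [denseEdges, hD] at this
  rw [not_lt] at hD
  set m := edgeCount G with hm
  have hq : 0 < blockRatio n m := by unfold blockRatio; omega
  have hk0 := pathBound_pos (n := n) edgeCount_le hD
  obtain ⟨w, hw⟩ := (blockSets_spec hn edgeCount_le hD).2.1
    (F.image fun r => (r.2 : ℕ) % (blockRatio n m * pathBound n m)) (by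
      intro b hb
      obtain ⟨r, _, rfl⟩ := mem_image.1 hb
      exact mem_range.2 (Nat.mod_lt _ (Nat.mul_pos hq hk0))) (card_image_le.trans hk)
  have h : ∃ w, ∀ r ∈ F, IsAssigned m w r := ⟨w, fun r hr => hw (mem_image_of_mem _ hr)⟩
  rw [ownerOf, dif_pos h]
  exact h.choose_spec r hr

end Distribution

end CongestedClique

/-! ### Finding levels with few paths. -/

namespace CongestedClique

open Finset SimpleGraph

variable {n B t : ℕ} {X Y Z : Type}

section Levels

/-- One round in which subsets of `{0, …, N - 1}` are sent. -/
theorem Knows.exchangeSet {f : SimpleGraph (Fin n) → Fin n → X} [Nonempty X] {N : ℕ} (hN : N ≤ B)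
    (hf : Knows B t f) {s : SimpleGraph (Fin n) → Fin n → Fin n → Finset ℕ}
    (hs : ∀ G v u, s G v u ⊆ range N) (hdet : Determines f s) :
    Knows B (t + 1) fun G v => (f G v, fun u => s G u v) := by
  have k1 := hf.exchange (M := Finset (Fin N))
    (by simpa using Nat.pow_le_pow_right (by norm_num) hN)
    (m := fun G v u => {i | (i : ℕ) ∈ s G v u}) (by
      intro G G' v h
      simp only [hdet G G' v h])
  refine k1.mono (determines_fst.prodMk ?_)
  intro G G' v h
  have h1 := congrArg Prod.snd h
  funext u
  have h2 := Finset.ext_iff.1 (congrFun h1 u)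
  ext i
  by_cases hi : i < N
  · simpa using h2 ⟨i, hi⟩
  · exact iff_of_false (fun h => hi (mem_range.1 (hs G u v h)))
      (fun h => hi (mem_range.1 (hs G' u v h)))

/-- Adding `r` makes a monotone sequence strictly increasing, hence recoverable from its set of
values. So `O(log n)` counts of bit length `O(log n)` fit into one bit set of `O(log n)` bits. -/
theorem eq_of_image_add_eq {k : ℕ} {f g : ℕ → ℕ} (hf : Monotone f) (hg : Monotone g)
    (h : (range (k + 1)).image (fun r => r + f r) = (range (k + 1)).image (fun r => r + g r))
    {r : ℕ} (hr : r ≤ k) : f r = g r := by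
  have hmono : ∀ {f : ℕ → ℕ}, Monotone f → StrictMono fun i : Fin (k + 1) => (i : ℕ) + f i :=
    fun hf i j hij => Nat.add_lt_add_of_lt_of_le hij (hf hij.le)
  have hrange : ∀ f : ℕ → ℕ, Set.range (fun i : Fin (k + 1) => (i : ℕ) + f i) =
      ((range (k + 1)).image (fun r => r + f r) : Finset ℕ) := by
    intro f
    ext x
    simp only [Set.mem_range, coe_image, Set.mem_image, mem_coe, mem_range]
    constructor
    · rintro ⟨i, rfl⟩; exact ⟨i, i.2, rfl⟩
    · rintro ⟨i, hi, rfl⟩; exact ⟨⟨i, hi⟩, rfl⟩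
  have h1 := ((hmono hf).range_inj (hmono hg)).1 (by rw [hrange, hrange, h])
  have h2 := congrFun h1 ⟨r, Nat.lt_succ_of_le hr⟩
  simpa using h2

/-- The power of two approximating `x` up to a factor of two, for numbers `x` up to `2 * n`. -/
def estimate (n x : ℕ) : ℕ := 2 ^ Nat.size (min x (2 * n + 2)) / 2

theorem estimate_le (n x : ℕ) : estimate n x ≤ x := by
  refine le_trans ?_ (min_le_left x (2 * n + 2))
  unfold estimate
  set y := min x (2 * n + 2)
  rcases h : Nat.size y with _ | s
  · simp
  · rw [pow_succ, Nat.mul_div_cancel _ (by norm_num)]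
    exact Nat.lt_size.1 (by omega)

/-- The cap `2 * n + 2` does no harm: a capped count has an estimate above `n`, which the hypothesis
excludes. -/
theorem le_two_mul_estimate {n x : ℕ} (h : estimate n x ≤ n) : x ≤ 2 * estimate n x := by
  have h1 := Nat.lt_size_self (min x (2 * n + 2))
  unfold estimate at h ⊢
  rcases hs : Nat.size (min x (2 * n + 2)) with _ | s
  · rw [Nat.size_eq_zero] at hs
    omega
  · rw [hs] at h h1
    rw [pow_succ, Nat.mul_div_cancel _ (by norm_num)] at h ⊢
    rw [pow_succ] at h1
    omega

/-- The levels `r ≤ k` at which the estimated sum of the counts is at most `n`. -/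
def goodLevels (k : ℕ) (cnt : Fin n → ℕ → ℕ) : Finset ℕ :=
  {r ∈ range (k + 1) | ∑ w, estimate n (cnt w r) ≤ n}

theorem mem_goodLevels_of_sum_le {k r : ℕ} {cnt : Fin n → ℕ → ℕ} (hr : r ≤ k)
    (h : ∑ w, cnt w r ≤ n) : r ∈ goodLevels k cnt :=
  mem_filter.2 ⟨mem_range.2 (Nat.lt_succ_of_le hr),
    (sum_le_sum fun _ _ => estimate_le _ _).trans h⟩

theorem sum_le_of_mem_goodLevels {k r : ℕ} {cnt : Fin n → ℕ → ℕ} (h : r ∈ goodLevels k cnt) :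
    ∑ w, cnt w r ≤ 2 * n := by
  have h1 := (mem_filter.1 h).2
  calc ∑ w, cnt w r ≤ ∑ w, 2 * estimate n (cnt w r) := by
        refine sum_le_sum fun w _ => le_two_mul_estimate ?_
        exact (single_le_sum (f := fun w => estimate n (cnt w r)) (fun _ _ => Nat.zero_le _)
          (mem_univ w)).trans h1
    _ = 2 * ∑ w, estimate n (cnt w r) := (mul_sum _ _ _).symm
    _ ≤ 2 * n := Nat.mul_le_mul_left _ h1

/-- If every node `w` knows numbers `cnt w v r` for all nodes `v` and levels `r`, monotone in `r`,
then two rounds suffice for all nodes to know the good levels of all nodes. -/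
theorem Knows.exchangeGoodLevels {f : SimpleGraph (Fin n) → Fin n → X} [Nonempty X] (hn : 2 ≤ n)
    (hB : 6 * Nat.log 2 n ≤ B) (hf : Knows B t f) {k : SimpleGraph (Fin n) → ℕ}
    {cnt : SimpleGraph (Fin n) → Fin n → Fin n → ℕ → ℕ} (hmono : ∀ G w v, Monotone (cnt G w v))
    (hk : ∀ G, k G ≤ Nat.log 2 n) (hkdet : Determines f fun G _ => k G) (hdet : Determines f cnt) :
    Knows B (t + 2) fun G v => (f G v, fun u => goodLevels (k G) fun w => cnt G w u) := by
  have hL : 1 ≤ Nat.log 2 n := Nat.log_pos (by norm_num) hn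
  let size : SimpleGraph (Fin n) → Fin n → Fin n → ℕ → ℕ :=
    fun G w v r => Nat.size (min (cnt G w v r) (2 * n + 2))
  have hsize : ∀ G w v, Monotone (size G w v) := fun G w v r r' h =>
    Nat.size_le_size (min_le_min_right _ (hmono G w v h))
  have k1 := hf.exchangeSet hB
    (s := fun G w v => (range (k G + 1)).image fun r => r + size G w v r) (by
      intro G w v x hx
      obtain ⟨r, hr, rfl⟩ := mem_image.1 hx
      have h1 : r ≤ Nat.log 2 n := (Nat.lt_succ_iff.1 (mem_range.1 hr)).trans (hk G)
      have h2 : size G w v r ≤ Nat.log 2 n + 3 := by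
        refine Nat.size_le.2 ((min_le_right _ _).trans_lt ?_)
        have h3 := Nat.lt_pow_succ_log_self (b := 2) (by norm_num) n
        rw [pow_succ] at h3
        rw [pow_add]
        omega
      rw [mem_range]
      omega) (by
      intro G G' w h
      have h1 : k G = k G' := hkdet G G' w h
      simp only [size, hdet G G' w h, h1])
  refine (k1.exchangeSet (N := Nat.log 2 n + 1) (by omega)
    (s := fun G v _ => goodLevels (k G) fun w => cnt G w v) ?_ ?_).mono ?_
  · intro G v _ r hr
    have h1 := mem_range.1 (mem_filter.1 hr).1
    have h2 := hk G
    rw [mem_range]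
    omega
  · intro G G' v h
    have h1 : k G = k G' := hkdet G G' v (congrArg Prod.fst h)
    have h2 := congrArg Prod.snd h
    funext _
    simp only [goodLevels, h1]
    refine filter_congr fun r hr => ?_
    have h3 : ∀ w, estimate n (cnt G w v r) = estimate n (cnt G' w v r) := by
      intro w
      have h4 := congrFun h2 w
      simp only [h1] at h4
      have h5 := eq_of_image_add_eq (hsize G w v) (hsize G' w v) h4
        (Nat.lt_succ_iff.1 (mem_range.1 hr))
      simp only [size] at h5
      rw [estimate, h5, estimate]
    simp only [h3]
  · exact (determines_fst.trans determines_fst).prodMk determines_snd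

end Levels

/-! ### Sharing the work of overloaded nodes. -/

section Helpers

/-- Portions of at most `n` units of the works of sizes `c w` of the nodes `w`. -/
def portions (c : Fin n → ℕ) : Finset (Σ _ : Fin n, ℕ) :=
  univ.sigma fun w => range (c w / n + 1)

/-- The node that does the `j`-th portion of the work of the node `w`. -/
noncomputable def helper (c : Fin n → ℕ) (w : Fin n) (j : ℕ) : Fin n :=
  ⟨rank (portions c) ⟨w, j⟩ % n, Nat.mod_lt _ w.pos⟩

/-- The node `h` does some of the work of the node `w`. -/
def IsHelper (c : Fin n → ℕ) (w h : Fin n) : Prop := ∃ j ≤ c w / n, helper c w j = h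

/-- Full portions number at most `2 * n`, and rounding costs one more per node. -/
theorem card_portions_le {c : Fin n → ℕ} (hn : 0 < n) (hc : ∑ w, c w ≤ 2 * n * n) :
    #(portions c) ≤ 3 * n := by
  have h1 : ∑ w, c w / n ≤ 2 * n := by
    refine Nat.le_of_mul_le_mul_right ?_ hn
    rw [sum_mul]
    exact (sum_le_sum fun w _ => Nat.div_mul_le_self _ _).trans hc
  rw [portions, card_sigma]
  simp only [card_range, sum_add_distrib, sum_const, card_univ, Fintype.card_fin, smul_eq_mul,
    mul_one]
  omega

theorem card_portions_helper_le {c : Fin n → ℕ} (hn : 0 < n) (hc : ∑ w, c w ≤ 2 * n * n)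
    (h : Fin n) : #{x ∈ portions c | helper c x.1 x.2 = h} ≤ 3 := by
  have := card_filter_rank_mod_le hn (card_portions_le hn hc) h
  simpa only [helper, Fin.ext_iff] using this

open Classical in
theorem card_isHelper_le {c : Fin n → ℕ} (hn : 0 < n) (hc : ∑ w, c w ≤ 2 * n * n) (h : Fin n) :
    #{w | IsHelper c w h} ≤ 3 := by
  refine le_trans (card_le_card ?_)
    ((card_image_le (f := Sigma.fst)).trans (card_portions_helper_le hn hc h))
  intro w hw
  obtain ⟨j, hj, hh⟩ := (mem_filter.1 hw).2
  refine mem_image.2 ⟨⟨w, j⟩, mem_filter.2 ⟨?_, hh⟩, rfl⟩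
  exact mem_sigma.2 ⟨mem_univ _, mem_range.2 (Nat.lt_succ_of_le hj)⟩

variable {ε : Type} [Fintype ε] [DecidableEq ε]

open Classical in
/-- Every node `w` can tell its data `K w` of size `O(n)` to all its helpers. -/
theorem Knows.helpers {f : SimpleGraph (Fin n) → Fin n → X} [Nonempty X] (hn : 2 ≤ n) (a : ℕ)
    (hMsg : Fintype.card ε ≤ n ^ a) (hB : (2 * (a + 2) + 1) * 18 * Nat.log 2 n ≤ B)
    {K : SimpleGraph (Fin n) → Fin n → Finset ε} (hK : ∀ G w, #(K G w) ≤ 6 * n)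
    {c : SimpleGraph (Fin n) → Fin n → ℕ} (hc : ∀ G, ∑ w, c G w ≤ 2 * n * n)
    (hf : Knows B t f) (hcdet : Determines f fun G _ => c G) (hKdet : Determines f K) :
    Knows B (t + 2) fun G v => (f G v, fun w => if IsHelper (c G) w v then K G w else ∅) := by
  have hn0 : 0 < n := by omega
  have hbw : ∀ a' K', a' ≤ a + 2 → K' ≤ 18 → (2 * a' + 1) * K' * Nat.log 2 n ≤ B := by
    intro a' K' h1 h2
    refine le_trans ?_ hB
    gcongr
  -- Each node deals its data to all nodes, at most six elements per link, and these forward it to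
  -- all its helpers. A helper serves at most three nodes, hence `18` elements per link.
  let mid : SimpleGraph (Fin n) → ε × Fin n → Fin n := fun G x =>
    ⟨rank (K G x.2) x.1 % n, Nat.mod_lt _ hn0⟩
  have hmid : ∀ G u y, #{r ∈ K G u | mid G (r, u) = y} ≤ 6 := by
    intro G u y
    have := card_filter_rank_mod_le hn0 (hK G u) y
    simpa only [mid, Fin.ext_iff] using this
  have k1 := hf.forward hn (a + 1) 6 (Msg := ε × Fin n) (by
      rw [Fintype.card_prod, Fintype.card_fin, pow_succ]
      exact Nat.mul_le_mul_right _ hMsg) (hbw _ _ (by omega) (by omega))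
    (fun G => {x | x.1 ∈ K G x.2}) (fun _ x => x.2) mid (by
      intro G u y
      refine (card_le_card_of_injOn Prod.fst ?_ ?_).trans (hmid G u y)
      · rintro ⟨r, w⟩ hx
        simp only [mem_coe, mem_filter, mem_univ, true_and] at hx
        obtain ⟨h1, rfl, h2⟩ := hx
        exact mem_filter.2 ⟨h1, h2⟩
      · intro x hx x' hx' h
        simp only [mem_coe, mem_filter] at hx hx'
        exact Prod.ext h (hx.2.1.trans hx'.2.1.symm)) (by
      intro G G' v h
      have h1 := hKdet G G' v h
      ext x
      simp only [mem_filter, mem_univ, true_and]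
      constructor
      · rintro ⟨h2, rfl⟩; exact ⟨h1 ▸ h2, rfl⟩
      · rintro ⟨h2, rfl⟩; exact ⟨h1 ▸ h2, rfl⟩) (by
      intro G G' v h m _ hv
      have h1 := hKdet G G' v h
      simp only [mid, hv, h1])
  have k2 := k1.forward hn (a + 2) 18 (Msg := (ε × Fin n) × Fin n) (by
      rw [Fintype.card_prod, Fintype.card_prod, Fintype.card_fin, pow_succ, pow_succ]
      exact Nat.mul_le_mul_right _ (Nat.mul_le_mul_right _ hMsg)) hB
    (fun G => {x | x.1.1 ∈ K G x.1.2 ∧ IsHelper (c G) x.1.2 x.2}) (fun G x => mid G x.1)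
    (fun _ x => x.2) (by
      intro G y h
      calc _ ≤ #(({w | IsHelper (c G) w h} : Finset (Fin n)).sigma
              fun w => {r ∈ K G w | mid G (r, w) = y}) := by
            refine card_le_card_of_injOn (fun x => ⟨x.1.2, x.1.1⟩) ?_ ?_
            · rintro ⟨⟨r, w⟩, h'⟩ hx
              simp only [mem_coe, mem_filter, mem_univ, true_and] at hx
              obtain ⟨⟨h1, h2⟩, h3, rfl⟩ := hx
              simp only [mem_coe, mem_sigma, mem_filter, mem_univ, true_and]
              exact ⟨h2, h1, h3⟩
            · rintro ⟨⟨r, w⟩, h1⟩ hx ⟨⟨r', w'⟩, h1'⟩ hx' h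
              simp only [mem_coe, mem_filter] at hx hx'
              simp only [Sigma.mk.injEq, heq_eq_eq] at h
              rw [h.1, h.2, hx.2.2, hx'.2.2]
        _ ≤ ∑ w ∈ {w | IsHelper (c G) w h}, 6 := by
            rw [card_sigma]
            exact sum_le_sum fun w _ => hmid G w y
        _ ≤ 18 := by
            rw [sum_const, smul_eq_mul]
            have := card_isHelper_le hn0 (hc G) h
            omega) (by
      intro G G' y h
      have h1 := hcdet G G' y (congrArg Prod.fst h)
      have h2 := congrArg Prod.snd h
      ext x
      have h3 := Finset.ext_iff.1 h2 x.1
      simp only [mem_filter, mem_univ, true_and] at h3 ⊢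
      simp only at h1
      rw [h1]
      tauto) (fun _ _ _ _ _ _ _ => rfl)
  refine k2.mono ((determines_fst.trans determines_fst).prodMk ?_)
  intro G G' v h
  have h1 := hcdet G G' v (congrArg (fun x => x.1.1) h)
  have h2 := congrArg Prod.snd h
  simp only at h1
  funext w
  simp only [h1]
  split_ifs with hw
  · ext r
    have h3 := Finset.ext_iff.1 h2 ((r, w), v)
    simpa [h1, hw] using h3
  · rfl

end Helpers

end CongestedClique

/-! ### Detecting two paths with the same ends. -/

namespace CongestedClique

open Finset SimpleGraph

variable {n B t : ℕ} {X Y Z : Type}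

/-- There are two paths with the same ends and at most `r` edges. -/
def HasTwoPaths {ε : Type} (e : ε → Sym2 (Fin n)) (E : Finset ε) (r : ℕ) : Prop :=
  ∃ v u, ∃ F ⊆ E, ∃ F' ⊆ E, F ≠ F' ∧ IsPathSet e v u F ∧ IsPathSet e v u F' ∧ #F ≤ r ∧ #F' ≤ r

theorem not_hasTwoPaths_zero {ε : Type} {e : ε → Sym2 (Fin n)} {E : Finset ε} : ¬ HasTwoPaths e E 0 := by
  rintro ⟨v, u, F, _, F', _, hne, _, _, h, h'⟩
  rw [Nat.le_zero, card_eq_zero] at h h'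
  exact hne (h.trans h'.symm)

variable {ε : Type} [DecidableEq ε]

open Classical in
/-- The paths with at most `k` edges, all in `E`, each given by its ends and its edge set. -/
noncomputable def pathItems [Fintype ε] (e : ε → Sym2 (Fin n)) (E : Finset ε) (k : ℕ) :
    Finset (Fin n × Fin n × Finset ε) :=
  {x | x.2.2 ⊆ E ∧ #x.2.2 ≤ k ∧ IsPathSet e x.1 x.2.1 x.2.2}

/-- The paths with at most `r` edges owned by the node `w`. -/
noncomputable def heldItems [Fintype ε] (e : ε → Sym2 (Fin n)) (E : Finset ε) (k : ℕ) (own : Finset ε → Fin n)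
    (w : Fin n) (r : ℕ) : Finset (Fin n × Fin n × Finset ε) :=
  {x ∈ pathItems e E k | own x.2.2 = w ∧ #x.2.2 ≤ r}

variable {e : ε → Sym2 (Fin n)} {E : Finset ε} {k : ℕ} {own : Finset ε → Fin n}

theorem mem_heldItems [Fintype ε] {w : Fin n} {r : ℕ} {x : Fin n × Fin n × Finset ε} :
    x ∈ heldItems e E k own w r ↔
      (x.2.2 ⊆ E ∧ #x.2.2 ≤ k ∧ IsPathSet e x.1 x.2.1 x.2.2) ∧ own x.2.2 = w ∧ #x.2.2 ≤ r := by
  simp [heldItems, pathItems]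

/-- An owner can list its paths from its own data: any edge set it owns lies in `K`. -/
theorem heldItems_eq [Fintype ε] {K : Finset ε} {w : Fin n} {r : ℕ} (hKE : K ⊆ E)
    (h : ∀ F ⊆ E, #F ≤ k → own F = w → F ⊆ K) :
    heldItems e E k own w r = heldItems e K k own w r := by
  ext x
  simp only [mem_heldItems]
  constructor
  · rintro ⟨⟨h1, h2, h3⟩, h4, h5⟩
    exact ⟨⟨h _ h1 h2 h4, h2, h3⟩, h4, h5⟩
  · rintro ⟨⟨h1, h2, h3⟩, h4, h5⟩
    exact ⟨⟨h1.trans hKE, h2, h3⟩, h4, h5⟩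

theorem sum_card_heldItems_filter [Fintype ε] (v : Fin n) (r : ℕ) :
    ∑ w, #{x ∈ heldItems e E k own w r | x.1 = v} =
      #{x ∈ pathItems e E k | x.1 = v ∧ #x.2.2 ≤ r} := by
  rw [card_eq_sum_card_fiberwise (f := fun x => own x.2.2) (t := univ) (by simp)]
  refine sum_congr rfl fun w _ => ?_
  rw [heldItems, filter_filter, filter_filter]
  congr 1
  ext x
  simp only [mem_filter]
  tauto

/-- For a fixed start the end determines the path, as two paths would form a forbidden pair. -/
theorem sum_card_heldItems_filter_le [Fintype ε] {r : ℕ} (h : ¬ HasTwoPaths e E r) (v : Fin n) :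
    ∑ w, #{x ∈ heldItems e E k own w r | x.1 = v} ≤ n := by
  rw [sum_card_heldItems_filter]
  calc _ ≤ #(univ : Finset (Fin n)) := by
        refine card_le_card_of_injOn (fun x => x.2.1) (by simp) ?_
        rintro ⟨v, u, F⟩ hx ⟨v', u', F'⟩ hx' huu
        simp only [pathItems, mem_coe, mem_filter, mem_univ, true_and] at hx hx' huu
        obtain ⟨⟨h1, h2, h3⟩, rfl, h4⟩ := hx
        obtain ⟨⟨h1', h2', h3'⟩, rfl, h4'⟩ := hx'
        subst huu
        by_cases hF : F = F'
        · rw [hF]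
        · exact absurd ⟨_, _, F, h1, F', h1', hF, h3, h3', h4, h4'⟩ h
    _ = n := by simp

theorem sum_card_heldItems [Fintype ε] (r : ℕ) : ∑ w, #(heldItems e E k own w r) =
    ∑ v, ∑ w, #{x ∈ heldItems e E k own w r | x.1 = v} := by
  rw [sum_comm]
  exact sum_congr rfl fun w _ => card_eq_sum_card_fiberwise (by simp)

section Messages

/-- The messages about paths: the helper that sends it, the owner of the path, its number among the
paths of the owner, its ends, and its length. -/
abbrev PathMessage (n : ℕ) : Type :=
  Fin n × Fin n × Fin (2 * n * n + 1) × Fin n × Fin n × Fin (n + 1)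

theorem card_pathMessage_le (hn : 2 ≤ n) : Fintype.card (PathMessage n) ≤ n ^ 10 := by
  simp only [Fintype.card_prod, Fintype.card_fin]
  have h1 : n + 1 ≤ n ^ 2 := by nlinarith
  have h2 : 2 * n * n + 1 ≤ n ^ 4 := by
    have : 4 ≤ n * n := Nat.mul_le_mul hn hn
    nlinarith
  calc n * (n * ((2 * n * n + 1) * (n * (n * (n + 1))))) ≤ n * (n * (n ^ 4 * (n * (n * n ^ 2)))) := by
        gcongr
    _ = n ^ 10 := by ring

variable (c : Fin n → ℕ) (H : Fin n → Finset (Fin n × Fin n × Finset ε))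

/-- The message about the path `x` owned by `w`. -/
noncomputable def pathMessage (w : Fin n) (x : Fin n × Fin n × Finset ε) : PathMessage n :=
  (helper c w (rank (H w) x / n), w, Fin.ofNat _ (rank (H w) x), x.1, x.2.1, Fin.ofNat _ #x.2.2)

noncomputable def pathMessages : Finset (PathMessage n) :=
  univ.biUnion fun w => (H w).image (pathMessage c H w)

variable {c H}

theorem mem_pathMessages {m : PathMessage n} :
    m ∈ pathMessages c H ↔ ∃ w, ∃ x ∈ H w, pathMessage c H w x = m := by
  simp [pathMessages]

/-- Edge sets are too long to send; owner and rank identify a path instead. The bound on the total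
keeps ranks from wrapping around. -/
theorem pathMessage_injOn (hcH : ∀ w, #(H w) = c w) (hc : ∑ w, c w ≤ 2 * n * n)
    {w w' : Fin n} {x x' : Fin n × Fin n × Finset ε} (hx : x ∈ H w) (hx' : x' ∈ H w')
    (h : pathMessage c H w x = pathMessage c H w' x') : x = x' := by
  simp only [pathMessage, Prod.mk.injEq] at h
  obtain ⟨-, rfl, h1, -⟩ := h
  have hlt : ∀ x ∈ H w, rank (H w) x < 2 * n * n + 1 := fun x hx =>
    Nat.lt_succ_of_le ((rank_lt hx).le.trans ((hcH w).trans_le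
      ((single_le_sum (fun _ _ => Nat.zero_le _) (mem_univ w)).trans hc)))
  have h2 := congrArg Fin.val h1
  simp only [Fin.val_ofNat, Nat.mod_eq_of_lt (hlt x hx), Nat.mod_eq_of_lt (hlt x' hx')] at h2
  exact rank_injOn _ hx hx' h2

theorem card_pathMessages_source_le (hn : 0 < n) (hcH : ∀ w, #(H w) = c w)
    (hc : ∑ w, c w ≤ 2 * n * n) (h : Fin n) : #{m ∈ pathMessages c H | m.1 = h} ≤ 3 * n := by
  calc _ ≤ #({p ∈ portions c | helper c p.1 p.2 = h}.biUnion fun p =>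
          {x ∈ H p.1 | rank (H p.1) x / n = p.2}.image (pathMessage c H p.1)) := by
        refine card_le_card fun m hm => ?_
        simp only [mem_filter, mem_pathMessages] at hm
        obtain ⟨⟨w, x, hx, rfl⟩, hm⟩ := hm
        simp only [mem_biUnion, mem_filter, mem_image]
        refine ⟨⟨w, rank (H w) x / n⟩, ⟨?_, hm⟩, x, ⟨hx, rfl⟩, rfl⟩
        refine mem_sigma.2 ⟨mem_univ _, mem_range.2 (Nat.lt_succ_of_le (Nat.div_le_div_right ?_))⟩
        exact (rank_lt hx).le.trans (hcH w).le
    _ ≤ ∑ p ∈ {p ∈ portions c | helper c p.1 p.2 = h}, n :=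
        card_biUnion_le.trans (sum_le_sum fun p _ =>
          card_image_le.trans (card_filter_rank_div_le _ hn _))
    _ ≤ 3 * n := by
        rw [sum_const, smul_eq_mul]
        exact Nat.mul_le_mul_right _ (card_portions_helper_le hn hc h)

theorem card_pathMessages_target_le (v : Fin n) :
    #{m ∈ pathMessages c H | m.2.2.2.1 = v} ≤ ∑ w, #{x ∈ H w | x.1 = v} := by
  calc _ ≤ #((univ : Finset (Fin n)).biUnion fun w =>
          {x ∈ H w | x.1 = v}.image (pathMessage c H w)) := by
        refine card_le_card fun m hm => ?_
        simp only [mem_filter, mem_pathMessages] at hm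
        obtain ⟨⟨w, x, hx, rfl⟩, hm⟩ := hm
        simp only [mem_biUnion, mem_univ, true_and, mem_filter, mem_image]
        exact ⟨w, x, ⟨hx, hm⟩, rfl⟩
    _ ≤ _ := card_biUnion_le.trans (sum_le_sum fun p _ => card_image_le)

/-- A node that knows the paths of those whom it helps knows the messages it has to send. -/
theorem pathMessages_source_congr {H' : Fin n → Finset (Fin n × Fin n × Finset ε)} {h : Fin n}
    (hcH : ∀ w, #(H w) = c w) (hcH' : ∀ w, #(H' w) = c w) (hH : ∀ w, IsHelper c w h → H w = H' w) :
    {m ∈ pathMessages c H | m.1 = h} = {m ∈ pathMessages c H' | m.1 = h} := by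
  have key : ∀ {H H' : Fin n → Finset (Fin n × Fin n × Finset ε)}, (∀ w, #(H w) = c w) →
      (∀ w, IsHelper c w h → H w = H' w) →
      {m ∈ pathMessages c H | m.1 = h} ⊆ {m ∈ pathMessages c H' | m.1 = h} := by
    intro H H' hcH hH m hm
    simp only [mem_filter, mem_pathMessages] at hm ⊢
    obtain ⟨⟨w, x, hx, rfl⟩, hm⟩ := hm
    have hw : H w = H' w :=
      hH w ⟨_, Nat.div_le_div_right ((rank_lt hx).le.trans (hcH w).le), hm⟩
    exact ⟨⟨w, x, hw ▸ hx, by simp only [pathMessage, hw]⟩, hm⟩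
  exact Subset.antisymm (key hcH hH) (key hcH' fun w hw => (hH w hw).symm)

/-- The levels `r ≤ k` such that two messages to `v` concern paths with at most `r` edges and with
the same ends. -/
def collisionLevels (k : ℕ) (M : Finset (PathMessage n)) : Finset ℕ :=
  {r ∈ range (k + 1) | ∃ m ∈ M, ∃ m' ∈ M, m ≠ m' ∧ m.2.2.2.2.1 = m'.2.2.2.2.1 ∧
    (m.2.2.2.2.2 : ℕ) ≤ r ∧ (m'.2.2.2.2.2 : ℕ) ≤ r}

theorem collisionLevels_subset (k : ℕ) (M : Finset (PathMessage n)) :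
    collisionLevels k M ⊆ range (k + 1) :=
  filter_subset _ _

end Messages

/-- Every path with at most `s` edges is reported by its owner's helpers, and distinct messages with
equal ends come from distinct edge sets. Levels above `s` would not be fully reported. -/
theorem exists_mem_collisionLevels_iff [Fintype ε] {c : Fin n → ℕ} {s r : ℕ} (hkn : k ≤ n)
    (hcH : ∀ w, #(heldItems e E k own w s) = c w) (hc : ∑ w, c w ≤ 2 * n * n) (hrs : r ≤ s)
    (hsk : s ≤ k) :
    (∃ v, r ∈ collisionLevels k {m ∈ pathMessages c (fun w => heldItems e E k own w s) |
      m.2.2.2.1 = v}) ↔ HasTwoPaths e E r := by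
  have hlen : ∀ {w : Fin n} {x}, x ∈ heldItems e E k own w s → #x.2.2 % (n + 1) = #x.2.2 := by
    intro w x hx
    rw [mem_heldItems] at hx
    exact Nat.mod_eq_of_lt (by omega)
  simp only [collisionLevels, mem_filter, mem_range, mem_pathMessages]
  constructor
  · rintro ⟨v, -, _, ⟨⟨w, x, hx, rfl⟩, hv⟩, _, ⟨⟨w', x', hx', rfl⟩, hv'⟩, hne, hu, hr, hr'⟩
    simp only [pathMessage, Fin.val_ofNat, hlen hx, hlen hx'] at hv hv' hu hr hr'
    rw [mem_heldItems] at hx hx'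
    obtain ⟨⟨h1, h2, h3⟩, h4, h5⟩ := hx
    obtain ⟨⟨h1', h2', h3'⟩, h4', h5'⟩ := hx'
    refine ⟨v, x.2.1, x.2.2, h1, x'.2.2, h1', ?_, hv ▸ h3, by rw [hu, ← hv']; exact h3', hr, hr'⟩
    intro hF
    apply hne
    have hxx : x = x' := Prod.ext (hv.trans hv'.symm) (Prod.ext hu hF)
    rw [← h4, ← h4', hxx]
  · rintro ⟨v, u, F, hF, F', hF', hne, hp, hp', hr, hr'⟩
    have hx : (v, u, F) ∈ heldItems e E k own (own F) s :=
      mem_heldItems.2 ⟨⟨hF, by simp only; omega, hp⟩, rfl, by simp only; omega⟩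
    have hx' : (v, u, F') ∈ heldItems e E k own (own F') s :=
      mem_heldItems.2 ⟨⟨hF', by simp only; omega, hp'⟩, rfl, by simp only; omega⟩
    refine ⟨v, by omega, _, ⟨⟨_, _, hx, rfl⟩, rfl⟩, _, ⟨⟨_, _, hx', rfl⟩, rfl⟩, ?_, rfl, ?_, ?_⟩
    · intro h
      have := pathMessage_injOn hcH hc hx hx' h
      simp only [Prod.mk.injEq, true_and] at this
      exact hne this
    · simpa only [pathMessage, Fin.val_ofNat, hlen hx] using hr
    · simpa only [pathMessage, Fin.val_ofNat, hlen hx'] using hr'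

set_option maxHeartbeats 1000000 in
/-- Suppose that all sets of at most `k G` edges of `E G` are known to their owners. Then in 14
rounds, the nodes can find the maximum number `r ≤ k G` such that there are no two paths in `E G`
with the same ends and at most `r` edges. -/
theorem Knows.twoPathsLevel [Fintype ε] {f : SimpleGraph (Fin n) → Fin n → X} [Nonempty X]
    (hn : 2 ≤ n) (a : ℕ)
    (hMsg : Fintype.card ε ≤ n ^ a) (hB : (2 * (a + 2) + 1) * 18 * Nat.log 2 n ≤ B)
    (hB' : routingBandwidth 10 3 * Nat.log 2 n ≤ B) (e : ε → Sym2 (Fin n))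
    (E : SimpleGraph (Fin n) → Finset ε) (k : SimpleGraph (Fin n) → ℕ)
    (own : SimpleGraph (Fin n) → Finset ε → Fin n) (K : SimpleGraph (Fin n) → Fin n → Finset ε)
    (hk : ∀ G, k G ≤ Nat.log 2 n) (hK : ∀ G w, #(K G w) ≤ 6 * n) (hKE : ∀ G w, K G w ⊆ E G)
    (hown : ∀ G, ∀ F ⊆ E G, #F ≤ k G → F ⊆ K G (own G F))
    (hf : Knows B t f) (hkdet : Determines f fun G _ => k G)
    (howndet : Determines f fun G _ => own G) (hKdet : Determines f K) :
    ∃ s : SimpleGraph (Fin n) → ℕ, Knows B (t + 14) (fun G v => (f G v, s G)) ∧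
      ∀ G, s G ≤ k G ∧ ¬ HasTwoPaths e (E G) (s G) ∧
        (s G = k G ∨ HasTwoPaths e (E G) (s G + 1)) := by
  classical
  have hn0 : 0 < n := by omega
  have hkn : ∀ G, k G ≤ n := fun G => (hk G).trans (Nat.log_le_self _ _)
  have hBL : 632 * Nat.log 2 n ≤ B := by
    refine le_trans (Nat.mul_le_mul_right _ ?_) hB'
    norm_num [routingBandwidth]
  have hL : 1 ≤ Nat.log 2 n := Nat.log_pos (by norm_num) hn
  let H : SimpleGraph (Fin n) → Fin n → ℕ → Finset (Fin n × Fin n × Finset ε) :=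
    fun G w r => heldItems e (E G) (k G) (own G) w r
  have hHK : ∀ G w r, H G w r = heldItems e (K G w) (k G) (own G) w r := by
    intro G w r
    refine heldItems_eq (hKE G w) fun F hF hFk hFw => ?_
    rw [← hFw]
    exact hown G F hF hFk
  have hHdet : Determines f fun G w r => H G w r := by
    intro G G' w h
    funext r
    have h1 : k G = k G' := hkdet G G' w h
    have h2 : own G = own G' := howndet G G' w h
    simp only [hHK]
    rw [h1, h2, hKdet G G' w h]
  let cnt : SimpleGraph (Fin n) → Fin n → Fin n → ℕ → ℕ :=
    fun G w v r => #{x ∈ H G w r | x.1 = v}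
  -- a level at which the numbers of paths are bounded
  let good : SimpleGraph (Fin n) → Fin n → Finset ℕ :=
    fun G v => goodLevels (k G) fun w => cnt G w v
  have k1 := hf.exchangeGoodLevels hn (by omega) (k := k) (cnt := cnt) (by
      intro G w v r r' hrr
      refine card_le_card fun x hx => ?_
      simp only [H, mem_filter, mem_heldItems] at hx ⊢
      exact ⟨⟨hx.1.1, hx.1.2.1, hx.1.2.2.trans hrr⟩, hx.2⟩) hk hkdet (by
      intro G G' w h
      have h1 : H G w = H G' w := hHdet G G' w h
      simp only [cnt, h1])
  -- The largest level accepted at every start. Level `0` is always accepted, and no level without a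
  -- pair exceeds `r₁`.
  let r₁ : SimpleGraph (Fin n) → ℕ := fun G => Nat.findGreatest (fun r => ∀ v, r ∈ good G v) (k G)
  have hgood : ∀ G r, r ≤ k G → ¬ HasTwoPaths e (E G) r → ∀ v, r ∈ good G v :=
    fun G r hr h v => mem_goodLevels_of_sum_le hr (sum_card_heldItems_filter_le h v)
  have hr₁k : ∀ G, r₁ G ≤ k G := fun G => Nat.findGreatest_le _
  have hr₁ : ∀ G v, ∑ w, cnt G w v (r₁ G) ≤ 2 * n := by
    intro G v
    have h1 : ∀ v, r₁ G ∈ good G v :=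
      Nat.findGreatest_spec (P := fun r => ∀ v, r ∈ good G v) (Nat.zero_le _)
        (hgood G 0 (Nat.zero_le _) not_hasTwoPaths_zero)
    exact sum_le_of_mem_goodLevels (h1 v)
  have hr₁det : Determines (fun G v => (f G v, good G)) fun G _ => r₁ G := by
    intro G G' v h
    have h1 : k G = k G' := hkdet G G' v (congrArg Prod.fst h)
    have h2 : good G = good G' := congrArg Prod.snd h
    simp only [r₁, h1, h2]
  -- distribution of the work
  let c : SimpleGraph (Fin n) → Fin n → ℕ := fun G w => #(H G w (r₁ G))
  have hc : ∀ G, ∑ w, c G w ≤ 2 * n * n := by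
    intro G
    calc ∑ w, c G w = ∑ v, ∑ w, cnt G w v (r₁ G) := sum_card_heldItems _
      _ ≤ ∑ v : Fin n, 2 * n := sum_le_sum fun v _ => hr₁ G v
      _ = 2 * n * n := by rw [sum_const, card_univ, Fintype.card_fin, smul_eq_mul]; ring
  have k2 := k1.broadcast (M := Fin (2 * n * n + 1)) (by
      rw [Fintype.card_fin]
      have h1 : 2 * n * n ≤ n ^ 4 := by
        have : 4 ≤ n * n := Nat.mul_le_mul hn hn
        nlinarith
      have := succ_pow_le_two_pow (B := B) hn (K := 1) h1 (by omega)
      simpa using this)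
    (m := fun G w => ⟨c G w, Nat.lt_succ_of_le
      ((single_le_sum (fun _ _ => Nat.zero_le _) (mem_univ w)).trans (hc G))⟩) (by
      intro G G' w h
      have h1 : H G w = H G' w := hHdet G G' w (congrArg Prod.fst h)
      have h2 : r₁ G = r₁ G' := hr₁det G G' w h
      simp only [c, h1, h2])
  have k2' : Knows B (t + 3) fun G v => (f G v, good G, c G) := by
    refine k2.mono ?_
    intro G G' v h
    refine Prod.ext (congrArg (fun x => x.1.1) h) (Prod.ext (congrArg (fun x => x.1.2) h) ?_)
    have h1 := congrArg Prod.snd h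
    funext w
    exact congrArg Fin.val (congrFun h1 w)
  have k3 := k2'.helpers hn a hMsg hB hK hc
    (fun G G' v h => congrArg (fun x => x.2.2) h) (determines_fst.trans hKdet)
  -- the messages
  let A : SimpleGraph (Fin n) → Finset (PathMessage n) :=
    fun G => pathMessages (c G) fun w => H G w (r₁ G)
  have k4 := k3.route hn 10 3 (by omega) (card_pathMessage_le hn) hB' A (fun m => m.1)
    (fun m => m.2.2.2.1) (fun G v => card_pathMessages_source_le hn0 (fun _ => rfl) (hc G) v)
    (fun G v => (card_pathMessages_target_le v).trans ((hr₁ G v).trans (by omega))) (by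
      intro G G' v h
      have h1 : c G = c G' := congrArg (fun x => x.1.2.2) h
      have h2 : r₁ G = r₁ G' := hr₁det G G' v
        (Prod.ext (congrArg (fun x => x.1.1) h) (congrArg (fun x => x.1.2.1) h))
      have h3 := congrArg Prod.snd h
      have h4 : k G = k G' := hkdet G G' v (congrArg (fun x => x.1.1) h)
      have h5 : own G = own G' := howndet G G' v (congrArg (fun x => x.1.1) h)
      simp only [A]
      rw [← h1]
      refine pathMessages_source_congr (fun _ => rfl) (fun w => by rw [h1]) fun w hw => ?_
      have h6 := congrFun h3 w
      simp only [← h1, if_pos hw] at h6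
      rw [hHK, hHK, h2, h4, h5, h6])
  let coll : SimpleGraph (Fin n) → Fin n → Finset ℕ :=
    fun G v => collisionLevels (k G) {m ∈ A G | m.2.2.2.1 = v}
  have k5 := k4.exchangeSet (N := Nat.log 2 n + 1) (by omega) (s := fun G v _ => coll G v) (by
      intro G v _ r hr
      have h1 := mem_range.1 (collisionLevels_subset _ _ hr)
      have h2 := hk G
      rw [mem_range]
      omega) (by
      intro G G' v h
      have h1 : k G = k G' := hkdet G G' v (congrArg (fun x => x.1.1.1) h)
      have h2 : ({m ∈ A G | m.2.2.2.1 = v} : Finset (PathMessage n)) =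
        {m ∈ A G' | m.2.2.2.1 = v} := congrArg Prod.snd h
      funext _
      simp only [coll, h1, h2])
  have hcoll : ∀ G r, r ≤ r₁ G → ((∃ v, r ∈ coll G v) ↔ HasTwoPaths e (E G) r) :=
    fun G r hr => exists_mem_collisionLevels_iff (hkn G) (fun _ => rfl) (hc G) hr (hr₁k G)
  refine ⟨fun G => Nat.findGreatest (fun r => ∀ v, r ∉ coll G v) (r₁ G), ?_, fun G => ⟨?_, ?_, ?_⟩⟩
  · refine k5.mono ?_
    intro G G' v h
    have h1 : r₁ G = r₁ G' := hr₁det G G' v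
      (Prod.ext (congrArg (fun x => x.1.1.1.1) h) (congrArg (fun x => x.1.1.1.2.1) h))
    have h2 : coll G = coll G' := congrArg Prod.snd h
    refine Prod.ext (congrArg (fun x => x.1.1.1.1) h) ?_
    simp only [h1, h2]
  · exact (Nat.findGreatest_le _).trans (hr₁k G)
  · rw [← hcoll G _ (Nat.findGreatest_le _), not_exists]
    refine Nat.findGreatest_spec (P := fun r => ∀ v, r ∉ coll G v) (Nat.zero_le _) ?_
    rw [← not_exists, hcoll G 0 (Nat.zero_le _)]
    exact not_hasTwoPaths_zero
  · beta_reduce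
    rw [or_iff_not_imp_left]
    intro hne
    set s := Nat.findGreatest (fun r => ∀ v, r ∉ coll G v) (r₁ G) with hs
    have hsr : s ≤ r₁ G := Nat.findGreatest_le _
    have hrk := hr₁k G
    rcases hsr.lt_or_eq with hlt | heq
    · rw [← hcoll G _ hlt]
      by_contra hcon
      rw [not_exists] at hcon
      exact Nat.findGreatest_is_greatest (P := fun r => ∀ v, r ∉ coll G v) (Nat.lt_succ_self s) hlt
        hcon
    -- Here `s = r₁ < k`. Without a pair, level `s + 1` would have been accepted at every start,
    -- against the maximality of `r₁`.
    · by_contra hcon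
      exact Nat.findGreatest_is_greatest (P := fun r => ∀ v, r ∈ good G v) (n := k G)
        (k := s + 1) (by change r₁ G < _; omega) (by omega) (hgood G (s + 1) (by omega) hcon)

/-! ### Assembling the girth algorithm. -/

theorem hasTwoPaths_edgeRecords_iff {G : SimpleGraph (Fin n)} {r : ℕ} :
    HasTwoPaths (EdgeRecord.edge (n := n)) (edgeRecords G) r ↔ G.egirth ≤ (2 * r : ℕ) :=
  (egirth_le_two_mul_iff (fun _ => mem_edgeSet_iff_edgeRecords) edgeRecords_edge_injOn r).symm

theorem knows_girth (hn : 2 ≤ n) (hB : routingBandwidth 10 6 * Nat.log 2 n ≤ B) :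
    ∃ a : SimpleGraph (Fin n) → ℕ∞, Knows B 25 (fun G _ => a G) ∧
      ∀ G : SimpleGraph (Fin n), G.egirth = a G ∨ G.egirth = a G + 1 := by
  have hn0 : 0 < n := by omega
  have hbw : ∀ N ≤ routingBandwidth 10 6, N * Nat.log 2 n ≤ B :=
    fun N hN => (Nat.mul_le_mul_right _ hN).trans hB
  have : Nonempty (Finset (EdgeRecord n)) := ⟨∅⟩
  -- The search runs on `denseEdges`, which is empty for sparse graphs. So its load bounds hold for
  -- every graph, and its result is ignored in the sparse case.
  obtain ⟨s, hs, hspec⟩ := (knows_assignedEdges hn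
    (hbw _ (by norm_num [routingBandwidth]))).twoPathsLevel hn 4 card_edgeRecord_le
    (hbw _ (by norm_num [routingBandwidth])) (hbw _ (by norm_num [routingBandwidth]))
    EdgeRecord.edge denseEdges (fun G => pathBound n (edgeCount G))
    (fun G => ownerOf hn0 (edgeCount G)) assignedEdges (fun G => pathBound_le)
    (fun G => card_assignedEdges_le hn) (fun G w r hr => by classical exact (mem_filter.1 hr).1)
    (fun G F hF hFk r hr => by
      classical
      exact mem_filter.2 ⟨hF hr, isAssigned_ownerOf hn0 hF hFk hr⟩)
    (by
      intro G G' v h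
      have h1 : edgeCount G = edgeCount G' := congrArg Prod.fst h
      simp only [h1])
    (by
      intro G G' v h
      have h1 : edgeCount G = edgeCount G' := congrArg Prod.fst h
      simp only [h1])
    (fun G G' v h => congrArg (fun x => x.2.2) h)
  refine ⟨fun G => if edgeCount G / n < 6 then G.egirth else ((2 * s G + 1 : ℕ) : ℕ∞),
    hs.mono ?_, ?_⟩
  · intro G G' v h
    have h1 : edgeCount G = edgeCount G' := congrArg (fun x => x.1.1) h
    have h2 : sparseEdges G = sparseEdges G' := congrArg (fun x => x.1.2.1) h
    have h3 : s G = s G' := congrArg Prod.snd h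
    by_cases hD : edgeCount G / n < 6
    · have hD' : edgeCount G' / n < 6 := h1 ▸ hD
      simp only [sparseEdges, hD, hD', if_true] at h2
      rw [edgeRecords_injective h2]
    · have hD' : ¬ edgeCount G' / n < 6 := h1 ▸ hD
      simp only [hD, hD', if_false, h3]
  · intro G
    by_cases hD : edgeCount G / n < 6
    · simp only [hD, if_true, true_or]
    obtain ⟨-, h1, h2⟩ := hspec G
    simp only [denseEdges, hD, if_false, hasTwoPaths_edgeRecords_iff] at h1 h2 ⊢
    rw [not_lt] at hD
    have h3 : G.egirth ≤ (2 * (s G + 1) : ℕ) := by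
      rcases h2 with h2 | h2
      · rw [h2]
        -- When `s = k` the upper bound comes from density: `n < D ^ (k + 1)` by the choice of `k`
        -- as a logarithm.
        refine egirth_le_of_card_lt_pow (D := edgeCount G / n) hn0 (by omega)
          ((Nat.div_mul_le_self _ _).trans edgeCount_le_card_edgePairs) ?_
        exact Nat.lt_pow_succ_log_self (by omega) n
      · exact h2
    obtain ⟨g, hg⟩ := ENat.ne_top_iff_exists.1 (ne_top_of_le_ne_top (ENat.natCast_ne_top _) h3)
    rw [← hg, Nat.cast_le] at h1 h3
    rw [← hg]
    rcases (by omega : g = 2 * s G + 1 ∨ g = 2 * s G + 1 + 1) with h | h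
    · exact Or.inl (by rw [h])
    · exact Or.inr (by rw [h]; push_cast; ring)

end CongestedClique

open CongestedClique in
/-- There are constants `c`, `T` and, for every `n`, a deterministic Congested Clique algorithm on
`n` nodes with messages of `c * ⌊log₂ n⌋` bits that, on every graph `G` on `n` nodes, after `T`
rounds outputs at all nodes a common value `a` with girth of `G` in `{a, a + 1}`
(the girth is `⊤`, and so is `a`, if and only if `G` has no cycle). -/
theorem theorem1 :
    ∃ (c T : ℕ) (A : ∀ n : ℕ, CongestedCliqueAlgorithm n (c * Nat.log 2 n) ℕ∞),
      ∀ (n : ℕ) (G : SimpleGraph (Fin n)),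
        ∃ a : ℕ∞, (A n).OutputsAfter G T a ∧ G.egirth ∈ ({a, a + 1} : Set ℕ∞) := by
  have key : ∀ n, ∃ A : CongestedCliqueAlgorithm n (routingBandwidth 10 6 * Nat.log 2 n) ℕ∞,
      ∀ G : SimpleGraph (Fin n),
        ∃ a : ℕ∞, A.OutputsAfter G 25 a ∧ G.egirth ∈ ({a, a + 1} : Set ℕ∞) := by
    intro n
    rcases lt_or_ge n 2 with hn | hn
    -- Here `Nat.log 2 n = 0`, so messages are empty; at most one vertex leaves no cycle to find.
    · refine ⟨{ State := Unit, init := fun _ _ => (), send := fun _ _ _ => false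
                receive := fun _ _ => (), output := fun _ => ⊤ }, fun G => ⟨⊤, fun _ => rfl, ?_⟩⟩
      have : Subsingleton (Fin n) := Fin.subsingleton_iff_le_one.2 (by omega)
      rw [Subsingleton.elim G ⊥, SimpleGraph.egirth_bot]
      simp
    · obtain ⟨a, ha, hgirth⟩ := knows_girth hn le_rfl
      obtain ⟨A, hA⟩ := ha.exists_outputsAfter
      exact ⟨A, fun G => ⟨a G, hA G, hgirth G⟩⟩
  choose A hA using key
  exact ⟨_, 25, A, hA⟩
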